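/- Let $\mathfrak g$ be a finite-dimensional complex semisimple Lie algebra with a triangular decomposition $\mathfrak g=\mathfrak n_-\oplus\mathfrak h\oplus\mathfrak n_+$, given by a Cartan subalgebra $\mathfrak h$ and a base of its root system. For $\lambda,\mu\in\mathfrak h^*$ write $\lambda\leqslant\mu$ if $\mu-\lambda$ is a sum of finitely many (possibly zero) positive roots. A weight module is a $\mathfrak g$-module $M$ that is the direct sum of its weight spaces $M_\mu=\{m\in M : hm=\mu(h)m \text{ for all } h\in\mathfrak h\}$, $\mu\in\mathfrak h^*$. - $\mathcal O$ is the category of weight modules that are finitely generated over $U(\mathfrak n_-)$. - $\widetilde{\mathcal O}$ is the category of weight modules $M$ with $\dim M_\mu<\infty$ for all $\mu$ for which there are $\lambda_1,\dots,\lambda_k\in\mathfrak h^*$ such that every $\mu$ with $M_\mu\neq 0$ satisfies $\mu\leqslant\lambda_i$ for some $i$. - $\mathcal F(\Delta)$ is the category of modules $M\in\mathcal O$ that have a Verma filtration, that is, a finite chain of submodules $0=M_0\subseteq M_1\subseteq\dots\subseteq M_k=M$ such that each $M_i/M_{i-1}$ is isomorphic to a Verma module $\Delta(\mu_i)$, $\mu_i\in\mathfrak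 h^*$. - For a weight module $N$, $N^*=\bigoplus_{\mu}\operatorname{Hom}_{\mathbb C}(N_\mu,\mathbb C)$ is the restricted dual, with $\mathfrak g$-action $(xf)(n)=f(-xn)$. - For a weight module $M$ and $\lambda\in\mathfrak h^*$, $M^{\leqslant\lambda}$ is the quotient of $M$ by the submodule generated by all $M_\mu$ with $\mu\not\leqslant\lambda$. Let $N\in\widetilde{\mathcal O}$ and $\lambda\in\mathfrak h^*$. Then: 1. for every $M\in\mathcal F(\Delta)$, the module $(M\otimes N^*)^{\leqslant\lambda}$ lies in $\mathcal F(\Delta)$, and it is finitely generated and free over $U(\mathfrak n_-)$; 2. for every $M\in\mathcal O$, the module $(M\otimes N^*)^{\leqslant\lambda}$ lies in $\mathcal O$. -/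

import Mathlib

open scoped TensorProduct

noncomputable section

namespace CatO

open LieAlgebra LieModule

/-! ### Modules over universal enveloping algebras -/

section Enveloping

/-- A module over a complex Lie algebra `L`, regarded as a module over `U(L)`. -/
@[reducible] def envModule (L : Type*) [LieRing L] [LieAlgebra ℂ L]
    (M : Type*) [AddCommGroup M] [Module ℂ M] [LieRingModule L M] [LieModule ℂ L M] :
    Module (UniversalEnvelopingAlgebra ℂ L) M :=
  Module.compHom M (UniversalEnvelopingAlgebra.lift ℂ (LieModule.toEnd ℂ L M) :
    UniversalEnvelopingAlgebra ℂ L →ₐ[ℂ] Module.End ℂ M).toRingHom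

/-- `M` is finitely generated as a `U(L)`-module. -/
def EnvFinite (L : Type*) [LieRing L] [LieAlgebra ℂ L]
    (M : Type*) [AddCommGroup M] [Module ℂ M] [LieRingModule L M] [LieModule ℂ L M] : Prop :=
  letI := envModule L M
  Module.Finite (UniversalEnvelopingAlgebra ℂ L) M

/-- `M` is free as a `U(L)`-module. -/
def EnvFree (L : Type*) [LieRing L] [LieAlgebra ℂ L]
    (M : Type*) [AddCommGroup M] [Module ℂ M] [LieRingModule L M] [LieModule ℂ L M] : Prop :=
  letI := envModule L M
  Module.Free (UniversalEnvelopingAlgebra ℂ L) M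

end Enveloping

section Main

variable {𝔤 : Type*} [LieRing 𝔤] [LieAlgebra ℂ 𝔤] [FiniteDimensional ℂ 𝔤]
  [LieAlgebra.IsSemisimple ℂ 𝔤] {H : LieSubalgebra ℂ 𝔤} [H.IsCartanSubalgebra]

/-! ### Triangular decomposition and the order on weights

A Cartan subalgebra `H` and a base `b` of the root system give the triangular decomposition
`𝔤 = 𝔫₋ ⊕ H ⊕ 𝔫₊`, with `𝔫₊` (`𝔫₋`) the sum of the root spaces of positive (negative) roots. -/

/-- The subalgebra `𝔫₋`, the sum of the root spaces of the negatives of the positive roots. -/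
def nMinus (b : (IsKilling.rootSystem H).Base) : LieSubalgebra ℂ 𝔤 where
  __ := ⨆ i : {i : H.root // b.IsPos i},
    (rootSpace H (-(i.1.1 : H → ℂ))).toSubmodule
  lie_mem' := by
    intro x y hx hy
    change x ∈ ⨆ i : {i : H.root // b.IsPos i},
      (rootSpace H (-(i.1.1 : H → ℂ))).toSubmodule at hx
    change y ∈ ⨆ i : {i : H.root // b.IsPos i},
      (rootSpace H (-(i.1.1 : H → ℂ))).toSubmodule at hy
    change ⁅x, y⁆ ∈ ⨆ i : {i : H.root // b.IsPos i},
      (rootSpace H (-(i.1.1 : H → ℂ))).toSubmodule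
    induction hx using Submodule.iSup_induction' with
    | zero => simp
    | add x x' _ _ h h' => rw [add_lie]; exact add_mem h h'
    | mem i x hx =>
      induction hy using Submodule.iSup_induction' with
      | zero => simp
      | add y y' _ _ h h' => rw [lie_add]; exact add_mem h h'
      | mem j y hy =>
        have hxy : ⁅x, y⁆ ∈ rootSpace H (-(i.1.1 : H → ℂ) + -(j.1.1 : H → ℂ)) :=
          lie_mem_genWeightSpace_of_mem_genWeightSpace hx hy
        by_cases hbot : rootSpace H (-(i.1.1 : H → ℂ) + -(j.1.1 : H → ℂ)) = ⊥
        · rw [hbot, LieSubmodule.mem_bot] at hxy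
          rw [hxy]; exact zero_mem _
        · let γ : Weight ℂ H 𝔤 := ⟨_, hbot⟩
          let P := IsKilling.rootSystem H
          let _ := P.indexNeg
          have hneg : ∀ k : H.root, ((-k).1 : H → ℂ) = -(k.1 : H → ℂ) := by
            intro k
            have h : P.root (-k) = -P.root k := by simp
            funext t
            exact DFunLike.congr_fun h t
          have hγ : γ.IsNonZero := by
            intro h0
            have h1 : (j.1.1 : H → ℂ) = -(i.1.1 : H → ℂ) := by
              have h2 : -(i.1.1 : H → ℂ) + -(j.1.1 : H → ℂ) = 0 := h0
              rw [← sub_eq_add_neg, sub_eq_zero] at h2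
              exact h2.symm
            have h3 : j.1 = -i.1 := by
              apply Subtype.ext
              apply DFunLike.coe_injective
              rw [h1, hneg]
            have h4 := j.2
            rw [h3, RootPairing.Base.IsPos.neg_iff_not] at h4
            exact h4 i.2
          let k : H.root := ⟨γ, by simpa using hγ⟩
          have hk : b.IsPos (-k) := by
            refine RootPairing.Base.IsPos.add i.2 j.2 ?_
            ext h
            change ((-k).1 : H → ℂ) h = (i.1.1 : H → ℂ) h + (j.1.1 : H → ℂ) h
            rw [hneg]
            change -(-(i.1.1 : H → ℂ) h + -(j.1.1 : H → ℂ) h) = _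
            ring
          refine Submodule.mem_iSup_of_mem ⟨-k, hk⟩ ?_
          rw [hneg, neg_neg]
          exact hxy

/-- The natural partial order on `𝔥*`: `μ ≤ ν` iff `ν - μ` is a sum of positive roots
(equivalently, `μ - ν` is a sum of negative roots). -/
def WeightLE (b : (IsKilling.rootSystem H).Base) (μ ν : Module.Dual ℂ H) : Prop :=
  ν - μ ∈ AddSubmonoid.closure {β | ∃ i, b.IsPos i ∧ β = (IsKilling.rootSystem H).root i}

/-! ### Weight modules and the categories `𝒪` and `𝒪~`

Here `LieModule.weightSpace M μ` is the honest simultaneous eigenspace for `H`. -/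

section Categories

variable (H) in
/-- `M` is a weight module: it is the sum of its weight spaces
(such a sum is automatically direct). -/
def IsWeightModule (M : Type*) [AddCommGroup M] [Module ℂ M] [LieRingModule 𝔤 M]
    [LieModule ℂ 𝔤 M] : Prop :=
  ⨆ μ : Module.Dual ℂ H, (weightSpace M (μ : H → ℂ) : LieSubmodule ℂ H M) = ⊤

/-- The category `𝒪`: weight modules finitely generated over `U(𝔫₋)`. -/
structure InO (b : (IsKilling.rootSystem H).Base) (M : Type*) [AddCommGroup M] [Module ℂ M]
    [LieRingModule 𝔤 M] [LieModule ℂ 𝔤 M] : Prop where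
  isWeightModule : IsWeightModule H M
  finite : EnvFinite (nMinus b) M

/-- The enlarged category `𝒪~`: weight modules whose weights lie below finitely many given
weights, with finite-dimensional weight spaces. -/
structure InOTilde (b : (IsKilling.rootSystem H).Base) (M : Type*) [AddCommGroup M]
    [Module ℂ M] [LieRingModule 𝔤 M] [LieModule ℂ 𝔤 M] : Prop where
  isWeightModule : IsWeightModule H M
  support_le : ∃ S : Finset (Module.Dual ℂ H), ∀ μ : Module.Dual ℂ H,
    (weightSpace M (μ : H → ℂ) : LieSubmodule ℂ H M) ≠ ⊥ → ∃ ν ∈ S, WeightLE b μ ν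
  finiteDimensional : ∀ μ : Module.Dual ℂ H,
    FiniteDimensional ℂ (weightSpace M (μ : H → ℂ) : LieSubmodule ℂ H M)

end Categories

/-! ### Verma modules and Verma filtrations -/

/-- The left ideal of `U(𝔤)` generated by `𝔫₊` and all `h - wt h` with `h ∈ H`. -/
def vermaIdeal (b : (IsKilling.rootSystem H).Base) (wt : Module.Dual ℂ H) :
    Submodule (UniversalEnvelopingAlgebra ℂ 𝔤) (UniversalEnvelopingAlgebra ℂ 𝔤) :=
  Submodule.span _
    ({u | ∃ i, b.IsPos i ∧ ∃ x ∈ rootSpace H (i.1 : H → ℂ),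
        u = UniversalEnvelopingAlgebra.ι ℂ x} ∪
     {u | ∃ h : H, u = UniversalEnvelopingAlgebra.ι ℂ (h : 𝔤) -
        algebraMap ℂ (UniversalEnvelopingAlgebra ℂ 𝔤) (wt h)})

/-- The Verma module `Δ(wt)` of highest weight `wt`. -/
def Verma (b : (IsKilling.rootSystem H).Base) (wt : Module.Dual ℂ H) : Type _ :=
  UniversalEnvelopingAlgebra ℂ 𝔤 ⧸ vermaIdeal b wt

namespace Verma

variable (b : (IsKilling.rootSystem H).Base) (wt : Module.Dual ℂ H)

instance : AddCommGroup (Verma b wt) :=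
  inferInstanceAs (AddCommGroup (UniversalEnvelopingAlgebra ℂ 𝔤 ⧸ vermaIdeal b wt))

instance : Module (UniversalEnvelopingAlgebra ℂ 𝔤) (Verma b wt) :=
  inferInstanceAs (Module (UniversalEnvelopingAlgebra ℂ 𝔤)
    (UniversalEnvelopingAlgebra ℂ 𝔤 ⧸ vermaIdeal b wt))

instance : Module ℂ (Verma b wt) :=
  inferInstanceAs (Module ℂ (UniversalEnvelopingAlgebra ℂ 𝔤 ⧸ vermaIdeal b wt))

instance : IsScalarTower ℂ (UniversalEnvelopingAlgebra ℂ 𝔤) (Verma b wt) :=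
  inferInstanceAs (IsScalarTower ℂ (UniversalEnvelopingAlgebra ℂ 𝔤)
    (UniversalEnvelopingAlgebra ℂ 𝔤 ⧸ vermaIdeal b wt))

instance : SMulCommClass ℂ (UniversalEnvelopingAlgebra ℂ 𝔤) (Verma b wt) :=
  IsScalarTower.to_smulCommClass

instance : LieRingModule 𝔤 (Verma b wt) where
  bracket x m := UniversalEnvelopingAlgebra.ι ℂ x • m
  add_lie x y m := by
    rw [map_add, add_smul]
  lie_add x m n := smul_add _ _ _
  leibniz_lie x y m := by
    let _ := LieRing.ofAssociativeRing (A := UniversalEnvelopingAlgebra ℂ 𝔤)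
    change UniversalEnvelopingAlgebra.ι ℂ x • UniversalEnvelopingAlgebra.ι ℂ y • m =
      UniversalEnvelopingAlgebra.ι ℂ ⁅x, y⁆ • m +
        UniversalEnvelopingAlgebra.ι ℂ y • UniversalEnvelopingAlgebra.ι ℂ x • m
    rw [LieHom.map_lie, LieRing.of_associative_ring_bracket, sub_smul, mul_smul, mul_smul]
    abel

instance : LieModule ℂ 𝔤 (Verma b wt) where
  smul_lie t x m := by
    change UniversalEnvelopingAlgebra.ι ℂ (t • x) • m =
      t • UniversalEnvelopingAlgebra.ι ℂ x • m
    rw [map_smul, smul_assoc]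
  lie_smul t x m := smul_comm _ _ _

end Verma

/-- `M` has a Verma filtration: a finite chain of submodules
`0 = F 0 ≤ F 1 ≤ ⋯ ≤ F k = M` with `F (i + 1) / F i` isomorphic to a Verma module. -/
def HasVermaFiltration (b : (IsKilling.rootSystem H).Base) (M : Type*) [AddCommGroup M]
    [Module ℂ M] [LieRingModule 𝔤 M] [LieModule ℂ 𝔤 M] : Prop :=
  ∃ (k : ℕ) (F : Fin (k + 1) → LieSubmodule ℂ 𝔤 M),
    F 0 = ⊥ ∧ F (Fin.last k) = ⊤ ∧
    ∀ i : Fin k, F i.castSucc ≤ F i.succ ∧ ∃ wt : Module.Dual ℂ H,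
      Nonempty ((F i.succ ⧸ (F i.castSucc).comap (F i.succ).incl) ≃ₗ⁅ℂ, 𝔤⁆ Verma b wt)

/-- The category `ℱ(Δ)`: modules in `𝒪` that have a Verma filtration. -/
structure InFDelta (b : (IsKilling.rootSystem H).Base) (M : Type*) [AddCommGroup M]
    [Module ℂ M] [LieRingModule 𝔤 M] [LieModule ℂ 𝔤 M] : Prop where
  inO : InO b M
  hasVermaFiltration : HasVermaFiltration b M

/-! ### The restricted dual and the truncation -/

section Constructions

variable (H) in
/-- The restricted dual `M^* = ⨁_μ Hom(M_μ, ℂ)` of a weight module `M`, with `𝔤`-action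
`(x f)(m) = f (-x m)`. As `M` is the direct sum of its weight spaces, this is the submodule of
the full dual consisting of the functionals that vanish on all but finitely many weight spaces. -/
def restrictedDual (M : Type*) [AddCommGroup M] [Module ℂ M] [LieRingModule 𝔤 M]
    [LieModule ℂ 𝔤 M] : LieSubmodule ℂ 𝔤 (Module.Dual ℂ M) where
  carrier := {f | {μ : Module.Dual ℂ H |
    ∃ m ∈ (weightSpace M (μ : H → ℂ) : LieSubmodule ℂ H M), f m ≠ 0}.Finite}
  zero_mem' := by simp
  add_mem' := by
    intro f f' hf hf'
    refine (hf.union hf').subset ?_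
    rintro μ ⟨m, hm, hne⟩
    by_cases h : f m = 0
    · exact Or.inr ⟨m, hm, fun h' => hne (by simp [h, h'])⟩
    · exact Or.inl ⟨m, hm, h⟩
  smul_mem' := by
    intro c f hf
    refine hf.subset ?_
    rintro μ ⟨m, hm, hne⟩
    exact ⟨m, hm, fun h => hne (by simp [h])⟩
  lie_mem := by
    intro x f hf
    change Set.Finite {μ : Module.Dual ℂ H |
      ∃ m ∈ (weightSpace M (μ : H → ℂ) : LieSubmodule ℂ H M), f m ≠ 0} at hf
    change Set.Finite {μ : Module.Dual ℂ H |
      ∃ m ∈ (weightSpace M (μ : H → ℂ) : LieSubmodule ℂ H M), ⁅x, f⁆ m ≠ 0}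
    have hx : x ∈ ⨆ α : Weight ℂ H 𝔤, (rootSpace H (α : H → ℂ)).toSubmodule := by
      rw [← LieSubmodule.iSup_toSubmodule, LieModule.iSup_genWeightSpace_eq_top' ℂ H 𝔤]
      trivial
    induction hx using Submodule.iSup_induction' with
    | zero => simp
    | add x y _ _ h h' =>
      refine (h.union h').subset ?_
      rintro μ ⟨m, hm, hne⟩
      by_cases h : ⁅x, f⁆ m = 0
      · exact Or.inr ⟨m, hm, fun h' => hne (by rw [add_lie, LinearMap.add_apply, h, h', add_zero])⟩
      · exact Or.inl ⟨m, hm, h⟩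
    | mem α x hx =>
      refine (hf.preimage (f := fun μ => α.toLinear + μ)
        (add_right_injective _).injOn).subset ?_
      rintro μ ⟨m, hm, hne⟩
      refine ⟨⁅x, m⁆, ?_, fun h => hne (by simp [h])⟩
      rw [mem_weightSpace] at hm ⊢
      intro h
      have h1 : ⁅(h : 𝔤), x⁆ = α h • x :=
        LieAlgebra.IsKilling.lie_eq_smul_of_mem_rootSpace hx h
      have h2 : ⁅(h : 𝔤), m⁆ = μ h • m := hm h
      change ⁅(h : 𝔤), ⁅x, m⁆⁆ = (α h + μ h) • ⁅x, m⁆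
      rw [leibniz_lie, h1, h2, smul_lie, lie_smul, add_smul]

/-- The submodule of `M` generated by the weight spaces `M_μ` with `μ ≰ wt`. -/
def truncSubmodule (b : (IsKilling.rootSystem H).Base) (wt : Module.Dual ℂ H)
    (M : Type*) [AddCommGroup M] [Module ℂ M] [LieRingModule 𝔤 M] [LieModule ℂ 𝔤 M] :
    LieSubmodule ℂ 𝔤 M :=
  LieSubmodule.lieSpan ℂ 𝔤
    {m | ∃ μ : Module.Dual ℂ H, ¬ WeightLE b μ wt ∧
      m ∈ (weightSpace M (μ : H → ℂ) : LieSubmodule ℂ H M)}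

/-- The truncation `M^{≤ wt}`: the quotient of `M` by the submodule generated by the weight
spaces `M_μ` with `μ ≰ wt`. -/
abbrev Trunc (b : (IsKilling.rootSystem H).Base) (wt : Module.Dual ℂ H)
    (M : Type*) [AddCommGroup M] [Module ℂ M] [LieRingModule 𝔤 M] [LieModule ℂ 𝔤 M] : Type _ :=
  M ⧸ truncSubmodule b wt M

end Constructions

end Main

end CatO

end

/-!
If weight vectors `v i` generate `M` over `U(𝔫₋)` and `c j` is a basis of weight vectors of `X`,
then the `v i ⊗ c j` generate `M ⊗ X` over `U(𝔫₋)`, freely if the `v i` do. Since `U(𝔫₋)` lowers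
weights, a vector of weight `μ` lies in the span of the generators of weight at least `μ`. Hence the
truncation `(M ⊗ X)^{≤ wt}` kills exactly the span of the generators of weight `≰ wt`, and the
images of the others generate it, again freely if the `v i` do. For `X = N^*` and finitely many
`v i` only finitely many generators survive, because the weights of `N` are bounded above and
intervals in the order on weights are finite.

A module has a Verma filtration if and only if it has a finite `U(𝔫₋)`-basis of weight vectors: the
filtration adds the basis vectors in the order of decreasing height. Verma modules are free over
`U(𝔫₋)` because `U(𝔫₋)` carries an action of `𝔤` that extends left multiplication by `𝔫₋` and makes
`1` a highest weight vector; its construction replaces the Poincaré–Birkhoff–Witt theorem.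
-/

noncomputable section

namespace CatO

open LieAlgebra LieModule Submodule TensorProduct
open UniversalEnvelopingAlgebra (ι)

local notation "𝒰" => UniversalEnvelopingAlgebra

/-! ### Modules over enveloping algebras -/

section EnvelopingAlgebra

variable {R L : Type*} [CommRing R] [LieRing L] [LieAlgebra R L]

theorem ι_lie (x y : L) : (ι R ⁅x, y⁆ : 𝒰 R L) = ι R x * ι R y - ι R y * ι R x := by
  let _ := LieRing.ofAssociativeRing (A := 𝒰 R L)
  rw [LieHom.map_lie, LieRing.of_associative_ring_bracket]

theorem adjoin_range_ι : Algebra.adjoin R (Set.range (ι R : L → 𝒰 R L)) = ⊤ := by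
  let S := Algebra.adjoin R (Set.range (ι R : L → 𝒰 R L))
  let _ := LieRing.ofAssociativeRing (A := 𝒰 R L)
  let _ := LieRing.ofAssociativeRing (A := S)
  let f : L →ₗ⁅R⁆ S :=
    { toFun := fun x => ⟨ι R x, Algebra.subset_adjoin ⟨x, rfl⟩⟩
      map_add' := fun x y => Subtype.ext (map_add _ x y)
      map_smul' := fun c x => Subtype.ext (map_smul _ c x)
      map_lie' := fun {x y} => Subtype.ext (LieHom.map_lie _ x y) }
  have retraction : S.val.comp (UniversalEnvelopingAlgebra.lift R f) = AlgHom.id R (𝒰 R L) := by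
    ext x
    change (UniversalEnvelopingAlgebra.lift R f (ι R x) : 𝒰 R L) = ι R x
    rw [UniversalEnvelopingAlgebra.lift_ι_apply]
    rfl
  refine eq_top_iff.2 fun u _ => ?_
  rw [← AlgHom.id_apply (R := R) u, ← retraction]
  exact (UniversalEnvelopingAlgebra.lift R f u).2

section StableSubmodules

variable {M : Type*} [AddCommGroup M] [Module R M] [Module (𝒰 R L) M] [IsScalarTower R (𝒰 R L) M]
  {p : Submodule R M}

theorem smul_mem_of_ι_smul_mem (hp : ∀ (x : L), ∀ m ∈ p, ι R x • m ∈ p) (u : 𝒰 R L) {m : M}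
    (hm : m ∈ p) : u • m ∈ p := by
  have hu : u ∈ Algebra.adjoin R (Set.range (ι R : L → 𝒰 R L)) := by
    rw [adjoin_range_ι]; exact Algebra.mem_top
  induction hu using Algebra.adjoin_induction generalizing m with
  | mem _ hx => obtain ⟨x, rfl⟩ := hx; exact hp x m hm
  | algebraMap r => rw [algebraMap_smul]; exact p.smul_mem r hm
  | add _ _ _ _ hu hv => rw [add_smul]; exact p.add_mem (hu hm) (hv hm)
  | mul _ _ _ _ hu hv => rw [mul_smul]; exact hu (hv hm)

theorem mem_of_mem_env_span (hp : ∀ (x : L), ∀ m ∈ p, ι R x • m ∈ p) {S : Set M} (hS : S ⊆ p)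
    {m : M} (hm : m ∈ span (𝒰 R L) S) : m ∈ p := by
  induction hm using span_induction with
  | mem m hm => exact hS hm
  | zero => exact p.zero_mem
  | add _ _ _ _ hm hm' => exact p.add_mem hm hm'
  | smul u _ _ hm => exact smul_mem_of_ι_smul_mem hp u hm

end StableSubmodules

theorem env_induction {P : 𝒰 R L → Prop} (one : P 1) (add : ∀ u v, P u → P v → P (u + v))
    (smul : ∀ (c : R) u, P u → P (c • u)) (mul : ∀ x u, P u → P (ι R x * u)) (u : 𝒰 R L) :
    P u := by
  let p : Submodule R (𝒰 R L) :=
    { carrier := {u | P u}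
      add_mem' := fun {u v} => add u v
      zero_mem' := by simpa using smul 0 1 one
      smul_mem' := fun c {u} => smul c u }
  have : u • (1 : 𝒰 R L) ∈ p := smul_mem_of_ι_smul_mem (fun x m hm => mul x m hm) u one
  rwa [smul_eq_mul, mul_one] at this

/-- A linear map that commutes with the action of `L`, as a map of `U(L)`-modules. -/
def envLinear {M M' : Type*} [AddCommGroup M] [Module R M] [Module (𝒰 R L) M]
    [IsScalarTower R (𝒰 R L) M] [AddCommGroup M'] [Module R M'] [Module (𝒰 R L) M']
    [IsScalarTower R (𝒰 R L) M'] (f : M →ₗ[R] M')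
    (hf : ∀ (x : L) m, f (ι R x • m) = ι R x • f m) : M →ₗ[𝒰 R L] M' where
  toFun := f
  map_add' := map_add f
  map_smul' u m := by
    rw [RingHom.id_apply]
    induction u using env_induction generalizing m with
    | one => simp only [one_smul]
    | add u v hu hv => simp only [add_smul, map_add, hu, hv]
    | smul c u hu => simp only [smul_assoc, map_smul, hu]
    | mul x u hu => simp only [mul_smul, hf, hu]

/-- The algebra homomorphism `U(n) → U(L)` induced by the inclusion of a subalgebra `n` of `L`. -/
def envIncl (n : LieSubalgebra R L) : 𝒰 R n →ₐ[R] 𝒰 R L :=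
  letI := LieRing.ofAssociativeRing (A := 𝒰 R L)
  UniversalEnvelopingAlgebra.lift R ((ι R).comp n.incl)

@[simp] theorem envIncl_ι {n : LieSubalgebra R L} (y : n) : envIncl n (ι R y) = ι R (y : L) := by
  rw [envIncl, UniversalEnvelopingAlgebra.lift_ι_apply]
  rfl

section ToHom

/-- The left regular action of `L` on `U(L)`. Only a local instance: it is not the commutator
bracket. -/
@[reducible] def envLieRingModule (R L : Type*) [CommRing R] [LieRing L] [LieAlgebra R L] :
    LieRingModule L (𝒰 R L) where
  bracket x u := ι R x * u
  add_lie x y u := by rw [map_add, add_mul]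
  lie_add x u v := mul_add _ u v
  leibniz_lie x y u := by
    rw [ι_lie, sub_mul, mul_assoc, mul_assoc, sub_add_cancel]

attribute [local instance] envLieRingModule

theorem envLieModule (R L : Type*) [CommRing R] [LieRing L] [LieAlgebra R L] :
    LieModule R L (𝒰 R L) where
  smul_lie c x u := by
    change ι R (c • x) * u = c • (ι R x * u)
    rw [map_smul, smul_mul_assoc]
  lie_smul c x u := mul_smul_comm c (ι R x) u

attribute [local instance] envLieModule

variable {X : Type*} [AddCommGroup X] [Module R X] [LieRingModule L X] [LieModule R L X]

/-- The map `U(L) → Hom(X, U(L))` of `L`-modules that sends `1` to `φ`. It untwists tensor products: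
a `U(L)`-linear coordinate on `M` followed by this map is a `U(L)`-linear coordinate on `M ⊗ X`. -/
def envToHom (φ : X →ₗ[R] 𝒰 R L) : 𝒰 R L →ₗ[R] X →ₗ[R] 𝒰 R L :=
  LinearMap.applyₗ φ ∘ₗ
    (UniversalEnvelopingAlgebra.lift R (toEnd R L (X →ₗ[R] 𝒰 R L))).toLinearMap

@[simp] theorem envToHom_one (φ : X →ₗ[R] 𝒰 R L) : envToHom φ 1 = φ := by
  simp [envToHom]

theorem envToHom_ι_mul (φ : X →ₗ[R] 𝒰 R L) (y : L) (u : 𝒰 R L) (x : X) :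
    envToHom φ (ι R y * u) x = ι R y * envToHom φ u x - envToHom φ u ⁅y, x⁆ := by
  change UniversalEnvelopingAlgebra.lift R (toEnd R L (X →ₗ[R] 𝒰 R L)) (ι R y * u) φ x = _
  rw [map_mul, UniversalEnvelopingAlgebra.lift_ι_apply, Module.End.mul_apply,
    toEnd_apply_apply, LieHom.lie_apply]
  rfl

end ToHom

end EnvelopingAlgebra

section EnvModule

variable {L : Type*} [LieRing L] [LieAlgebra ℂ L]
  {M : Type*} [AddCommGroup M] [Module ℂ M] [LieRingModule L M] [LieModule ℂ L M]

attribute [local instance] envModule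

theorem env_smul_def (u : 𝒰 ℂ L) (m : M) :
    u • m = UniversalEnvelopingAlgebra.lift ℂ (toEnd ℂ L M) u m := rfl

theorem ι_smul (x : L) (m : M) : ι ℂ x • m = ⁅x, m⁆ := by
  rw [env_smul_def, UniversalEnvelopingAlgebra.lift_ι_apply, toEnd_apply_apply]

theorem envModule_isScalarTower : IsScalarTower ℂ (𝒰 ℂ L) M where
  smul_assoc c u m := by
    rw [env_smul_def, map_smul, LinearMap.smul_apply, ← env_smul_def]

attribute [local instance] envModule_isScalarTower

theorem lie_mem_of_mem (P : Submodule (𝒰 ℂ L) M) (x : L) {m : M} (hm : m ∈ P) : ⁅x, m⁆ ∈ P :=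
  ι_smul x m ▸ P.smul_mem _ hm

theorem mem_of_mem_span_of_lie_mem {p : Submodule ℂ M} (hp : ∀ (x : L), ∀ m ∈ p, ⁅x, m⁆ ∈ p)
    {S : Set M} (hS : S ⊆ p) {m : M} (hm : m ∈ span (𝒰 ℂ L) S) : m ∈ p :=
  mem_of_mem_env_span (fun x m hm => by rw [ι_smul]; exact hp x m hm) hS hm

/-- A morphism of `L`-modules, as a map of `U(L)`-modules. -/
def envHom {M' : Type*} [AddCommGroup M'] [Module ℂ M'] [LieRingModule L M'] [LieModule ℂ L M']
    (f : M →ₗ⁅ℂ,L⁆ M') : M →ₗ[𝒰 ℂ L] M' :=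
  envLinear (L := L) (f : M →ₗ[ℂ] M') fun x m => by rw [ι_smul, ι_smul]; exact f.map_lie x m

/-- An `L`-submodule, as a `U(n)`-submodule for a subalgebra `n` of `L`. -/
def envSubmodule (n : LieSubalgebra ℂ L) (K : LieSubmodule ℂ L M) : Submodule (𝒰 ℂ n) M where
  __ := K.toAddSubmonoid
  smul_mem' u _ hm := smul_mem_of_ι_smul_mem (p := K.toSubmodule)
    (fun x m hm => by rw [ι_smul]; exact K.lie_mem (x := (x : L)) hm) u hm

@[simp] theorem mem_envSubmodule {n : LieSubalgebra ℂ L} {K : LieSubmodule ℂ L M} {m : M} :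
    m ∈ envSubmodule n K ↔ m ∈ K := Iff.rfl

section Tensor

variable {X : Type*} [AddCommGroup X] [Module ℂ X] [LieRingModule L X] [LieModule ℂ L X]

theorem tmul_mem_of_lie_mem {P : Submodule (𝒰 ℂ L) (M ⊗[ℂ] X)} {S : Set M}
    (hS : ∀ m ∈ S, ∀ x : X, m ⊗ₜ[ℂ] x ∈ P) {m : M} (hm : m ∈ span (𝒰 ℂ L) S) (x : X) :
    m ⊗ₜ[ℂ] x ∈ P := by
  let q : Submodule ℂ M := ⨅ x : X, (P.restrictScalars ℂ).comap ((TensorProduct.mk ℂ M X).flip x)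
  have mem_q {m : M} : m ∈ q ↔ ∀ x : X, m ⊗ₜ[ℂ] x ∈ P := by simp [q]
  refine mem_q.1 (mem_of_mem_span_of_lie_mem (fun y m hm => ?_) (fun m hm => ?_) hm) x
  · refine mem_q.2 fun x => ?_
    -- Leibniz: `⁅y, m⁆ ⊗ x = ⁅y, m ⊗ x⁆ - m ⊗ ⁅y, x⁆`
    rw [← add_sub_cancel_right (⁅y, m⁆ ⊗ₜ[ℂ] x) (m ⊗ₜ[ℂ] ⁅y, x⁆),
      ← TensorProduct.LieModule.lie_tmul_right]
    exact P.sub_mem (lie_mem_of_mem P y (mem_q.1 hm x)) (mem_q.1 hm ⁅y, x⁆)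
  · exact mem_q.2 (hS m hm)

theorem span_tmul_eq_top {I J : Type*} {v : I → M} {c : J → X}
    (hv : span (𝒰 ℂ L) (Set.range v) = ⊤) (hc : span ℂ (Set.range c) = ⊤) :
    span (𝒰 ℂ L) (Set.range fun p : I × J => v p.1 ⊗ₜ[ℂ] c p.2) = ⊤ := by
  set P := span (𝒰 ℂ L) (Set.range fun p : I × J => v p.1 ⊗ₜ[ℂ] c p.2)
  have v_tmul_mem (i : I) (x : X) : v i ⊗ₜ[ℂ] x ∈ P := by
    have : span ℂ (Set.range c) ≤ (P.restrictScalars ℂ).comap (TensorProduct.mk ℂ M X (v i)) :=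
      span_le.2 (Set.range_subset_iff.2 fun j => subset_span ⟨(i, j), rfl⟩)
    exact this (hc ▸ mem_top)
  refine eq_top_iff.2 fun t _ => ?_
  induction t using TensorProduct.induction_on with
  | zero => exact P.zero_mem
  | tmul m x =>
    exact tmul_mem_of_lie_mem (Set.forall_mem_range.2 v_tmul_mem) (hv ▸ mem_top : m ∈ _) x
  | add s t hs ht => exact P.add_mem (hs trivial) (ht trivial)

/-- The `U(L)`-linear functional on `M ⊗ X` that combines a `U(L)`-linear functional `f` on `M` with
a linear functional `g` on `X`; if `f m = 1`, then it takes the value `g x` at `m ⊗ x`. -/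
def tmulFunctional (f : M →ₗ[𝒰 ℂ L] 𝒰 ℂ L) (g : X →ₗ[ℂ] ℂ) : M ⊗[ℂ] X →ₗ[𝒰 ℂ L] 𝒰 ℂ L :=
  envLinear (TensorProduct.lift (envToHom (g.smulRight 1) ∘ₗ f.restrictScalars ℂ)) fun y t => by
    rw [ι_smul]
    induction t using TensorProduct.induction_on with
    | zero => rw [lie_zero, map_zero, smul_zero]
    | add s t hs ht => rw [lie_add, map_add, map_add, hs, ht, smul_add]
    | tmul m x =>
      simp only [TensorProduct.LieModule.lie_tmul_right, map_add, TensorProduct.lift.tmul,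
        LinearMap.comp_apply, LinearMap.restrictScalars_apply, ← ι_smul (M := M) y m, map_smul,
        smul_eq_mul, envToHom_ι_mul, sub_add_cancel]

theorem tmulFunctional_tmul (f : M →ₗ[𝒰 ℂ L] 𝒰 ℂ L) (g : X →ₗ[ℂ] ℂ) (m : M) (x : X) :
    tmulFunctional f g (m ⊗ₜ x) = envToHom (g.smulRight 1) (f m) x := rfl

theorem linearIndependent_tmul {I J : Type*} {v : I → M} {c : J → X}
    (hv : LinearIndependent (𝒰 ℂ L) v) (hvs : span (𝒰 ℂ L) (Set.range v) = ⊤)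
    (hc : LinearIndependent ℂ c) :
    LinearIndependent (𝒰 ℂ L) (fun p : I × J => v p.1 ⊗ₜ[ℂ] c p.2) := by
  classical
  let B := Module.Basis.mk hv hvs.ge
  obtain ⟨r, hr⟩ :=
    LinearMap.exists_leftInverse_of_injective (Finsupp.linearCombination ℂ c)
      (LinearMap.ker_eq_bot.2 hc)
  have r_apply (j : J) : r (c j) = Finsupp.single j 1 := by
    simpa using DFunLike.congr_fun hr (Finsupp.single j 1)
  let F (p : I × J) := tmulFunctional (B.coord p.1) (Finsupp.lapply p.2 ∘ₗ r)
  have F_tmul (p q : I × J) : F p (v q.1 ⊗ₜ c q.2) = if q = p then 1 else 0 := by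
    have B_repr : B.repr (v q.1) = Finsupp.single q.1 1 := by simpa [B] using B.repr_self q.1
    rw [tmulFunctional_tmul, Module.Basis.coord_apply, B_repr, Finsupp.single_apply]
    by_cases h : q.1 = p.1 <;> simp [h, r_apply, Finsupp.single_apply, Prod.ext_iff]
  refine .of_pairwise_dual_eq_zero_one _ F (fun p q hne => ?_) fun p => ?_
  · exact (F_tmul p q).trans (if_neg hne.symm)
  · exact (F_tmul p p).trans (if_pos rfl)

end Tensor

end EnvModule

/-! ### The action of a Lie algebra on the enveloping algebra of a subalgebra -/

section InducedAction

variable {R 𝔤 : Type*} [CommRing R] [LieRing 𝔤] [LieAlgebra R 𝔤] {n : LieSubalgebra R 𝔤}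
  {φ : 𝔤 →ₗ[R] 𝒰 R n} {q : Submodule R 𝔤}

/-- The map `φ : 𝔤 → U(n)` extends `ι : n → U(n)` by a scalar-valued map on the supplement `q`
of `n`, and kills the brackets of elements of `q`. -/
structure ExtendsByCharacter (φ : 𝔤 →ₗ[R] 𝒰 R n) (q : Submodule R 𝔤) : Prop where
  sup_eq_top : n.toSubmodule ⊔ q = ⊤
  apply_coe (y : n) : φ y = ι R y
  exists_apply_eq_smul_one : ∀ x ∈ q, ∃ c : R, φ x = c • 1
  apply_lie : ∀ x ∈ q, ∀ x' ∈ q, φ ⁅x, x'⁆ = 0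

/-- The linear map `𝔤 → End(U(n))` determined by `x ↦ φ x` on `1` and the commutation relations
with the left multiplication by `n`. -/
def inducedMap (φ : 𝔤 →ₗ[R] 𝒰 R n) : 𝔤 →ₗ[R] Module.End R (𝒰 R n) := (envToHom φ).flip

@[simp] theorem inducedMap_one (φ : 𝔤 →ₗ[R] 𝒰 R n) (x : 𝔤) : inducedMap φ x 1 = φ x := by
  rw [inducedMap, LinearMap.flip_apply, envToHom_one]

theorem inducedMap_ι_mul (φ : 𝔤 →ₗ[R] 𝒰 R n) (x : 𝔤) (y : n) (u : 𝒰 R n) :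
    inducedMap φ x (ι R y * u) = ι R y * inducedMap φ x u - inducedMap φ ⁅(y : 𝔤), x⁆ u :=
  envToHom_ι_mul φ y u x

namespace ExtendsByCharacter

theorem inducedMap_coe (hφ : ExtendsByCharacter φ q) (y : n) (u : 𝒰 R n) :
    inducedMap φ y u = ι R y * u := by
  induction u using env_induction generalizing y with
  | one => rw [inducedMap_one, hφ.apply_coe, mul_one]
  | add u v hu hv => rw [map_add, hu, hv, mul_add]
  | smul c u hu => rw [map_smul, hu, mul_smul_comm]
  | mul x u hu =>
    rw [inducedMap_ι_mul, hu, ← LieSubalgebra.coe_bracket, hu, ι_lie, sub_mul, mul_assoc,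
      mul_assoc, sub_sub_cancel]

theorem inducedMap_lie_one (hφ : ExtendsByCharacter φ q) (z z' : 𝔤) :
    inducedMap φ ⁅z, z'⁆ 1 = inducedMap φ z (φ z') - inducedMap φ z' (φ z) := by
  have of_coe (y : n) (z : 𝔤) :
      inducedMap φ ⁅(y : 𝔤), z⁆ 1 = inducedMap φ y (φ z) - inducedMap φ z (φ y) := by
    rw [hφ.inducedMap_coe, hφ.apply_coe, ← mul_one (ι R y), inducedMap_ι_mul, mul_one,
      inducedMap_one, inducedMap_one, sub_sub_cancel]
  have of_mem {x x' : 𝔤} (hx : x ∈ q) (hx' : x' ∈ q) :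
      inducedMap φ ⁅x, x'⁆ 1 = inducedMap φ x (φ x') - inducedMap φ x' (φ x) := by
    obtain ⟨c, hc⟩ := hφ.exists_apply_eq_smul_one x hx
    obtain ⟨c', hc'⟩ := hφ.exists_apply_eq_smul_one x' hx'
    rw [inducedMap_one, hφ.apply_lie x hx x' hx', hc, hc', map_smul, map_smul, inducedMap_one,
      inducedMap_one, hc, hc', smul_comm, sub_self]
  obtain ⟨y, hy, x, hx, rfl⟩ := mem_sup.1 (hφ.sup_eq_top ▸ mem_top : z ∈ n.toSubmodule ⊔ q)
  obtain ⟨y', hy', x', hx', rfl⟩ := mem_sup.1 (hφ.sup_eq_top ▸ mem_top : z' ∈ n.toSubmodule ⊔ q)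
  have hyz := of_coe ⟨y, hy⟩ (y' + x')
  have hxy' : inducedMap φ ⁅x, y'⁆ 1 = inducedMap φ x (φ y') - inducedMap φ y' (φ x) := by
    rw [← lie_skew, map_neg, LinearMap.neg_apply, of_coe ⟨y', hy'⟩ x, neg_sub]
  simp only [add_lie, lie_add x, map_add, LinearMap.add_apply, of_mem hx hx', hxy'] at hyz ⊢
  rw [hyz]
  abel

theorem inducedMap_lie (hφ : ExtendsByCharacter φ q) (u : 𝒰 R n) (z z' : 𝔤) :
    inducedMap φ ⁅z, z'⁆ u =
      inducedMap φ z (inducedMap φ z' u) - inducedMap φ z' (inducedMap φ z u) := by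
  induction u using env_induction generalizing z z' with
  | one => rw [hφ.inducedMap_lie_one, inducedMap_one, inducedMap_one]
  | add u v hu hv => simp only [map_add, hu, hv]; abel
  | smul c u hu => simp only [map_smul, hu, smul_sub]
  | mul y u hu =>
    simp only [inducedMap_ι_mul, map_sub, leibniz_lie (y : 𝔤) z z', map_add, LinearMap.add_apply,
      hu, mul_sub]
    abel

/-- The action of `U(𝔤)` on `U(n)` that extends left multiplication by `n`, and for which
`x * 1 = φ x` for `x ∈ 𝔤`. -/
def action (hφ : ExtendsByCharacter φ q) : 𝒰 R 𝔤 →ₐ[R] Module.End R (𝒰 R n) :=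
  letI := LieRing.ofAssociativeRing (A := Module.End R (𝒰 R n))
  UniversalEnvelopingAlgebra.lift R
    { inducedMap φ with
      map_lie' := fun {z z'} => LinearMap.ext fun u => hφ.inducedMap_lie u z z' }

theorem action_ι (hφ : ExtendsByCharacter φ q) (x : 𝔤) : hφ.action (ι R x) = inducedMap φ x := by
  rw [action, UniversalEnvelopingAlgebra.lift_ι_apply]
  rfl

theorem action_envIncl (hφ : ExtendsByCharacter φ q) (u v : 𝒰 R n) :
    hφ.action (envIncl n u) v = u * v := by
  have : hφ.action.comp (envIncl n) = Algebra.lmul R (𝒰 R n) := by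
    let _ := LieRing.ofAssociativeRing (A := Module.End R (𝒰 R n))
    refine UniversalEnvelopingAlgebra.hom_ext R (LieHom.ext fun y => LinearMap.ext fun v => ?_)
    change hφ.action (envIncl n (ι R y)) v = ι R y * v
    rw [envIncl_ι, hφ.action_ι, hφ.inducedMap_coe]
  exact DFunLike.congr_fun (DFunLike.congr_fun this u) v

end ExtendsByCharacter

end InducedAction

/-! ### The order on weights -/

section WeightOrder

variable {𝔤 : Type*} [LieRing 𝔤] [LieAlgebra ℂ 𝔤] [FiniteDimensional ℂ 𝔤]
  [LieAlgebra.IsSemisimple ℂ 𝔤] {H : LieSubalgebra ℂ 𝔤} [H.IsCartanSubalgebra]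
  {b : (IsKilling.rootSystem H).Base}

theorem weightLE_refl (μ : Module.Dual ℂ H) : WeightLE b μ μ := by
  rw [WeightLE, sub_self]; exact zero_mem _

theorem WeightLE.trans {μ ν ξ : Module.Dual ℂ H} (h : WeightLE b μ ν) (h' : WeightLE b ν ξ) :
    WeightLE b μ ξ := by
  rw [WeightLE, ← sub_add_sub_cancel ξ ν μ]
  exact add_mem h' h

theorem weightLE_add_root {i : H.root} (hi : b.IsPos i) (μ : Module.Dual ℂ H) :
    WeightLE b μ (i.1.toLinear + μ) := by
  rw [WeightLE, add_sub_cancel_right]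
  exact AddSubmonoid.subset_closure ⟨i, hi, rfl⟩

theorem weightLE_sub_root {i : H.root} (hi : b.IsPos i) (μ : Module.Dual ℂ H) :
    WeightLE b (-i.1.toLinear + μ) μ := by
  simpa using weightLE_add_root hi (-i.1.toLinear + μ)

/-- The extension of the height of roots to `𝔥*`: the real part of the sum of the coordinates
in the base `b`. -/
def weightHeight (b : (IsKilling.rootSystem H).Base) : Module.Dual ℂ H →+ ℝ :=
  Complex.reAddGroupHom.comp (b.toWeightBasis.constr ℂ fun _ => (1 : ℂ)).toAddMonoidHom

theorem weightHeight_root (i : H.root) :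
    weightHeight b ((IsKilling.rootSystem H).root i) = b.height i := by
  obtain ⟨f, -, -, hf⟩ := b.exists_root_eq_sum_int i
  rw [RootPairing.Base.height_eq_sum hf, hf, map_sum, Int.cast_sum]
  refine Finset.sum_congr rfl fun j hj => ?_
  have : b.toWeightBasis.constr ℂ (fun _ => (1 : ℂ)) ((IsKilling.rootSystem H).root j) = 1 := by
    rw [← b.toWeightBasis_apply ⟨j, hj⟩, Module.Basis.constr_basis]
  rw [map_zsmul, weightHeight, AddMonoidHom.comp_apply, LinearMap.toAddMonoidHom_coe, this]
  simp

theorem one_le_weightHeight_root {i : H.root} (hi : b.IsPos i) :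
    1 ≤ weightHeight b ((IsKilling.rootSystem H).root i) := by
  rw [weightHeight_root]
  exact_mod_cast hi

open scoped Classical in
theorem WeightLE.exists_eq_sum {μ ν : Module.Dual ℂ H} (h : WeightLE b μ ν) :
    ∃ n : {i // b.IsPos i} → ℕ, ν - μ = ∑ i, n i • (IsKilling.rootSystem H).root i := by
  refine AddSubmonoid.exists_of_mem_closure_range
    (fun i : {i // b.IsPos i} => (IsKilling.rootSystem H).root i) _ ?_
  rw [WeightLE] at h
  convert h using 2
  ext β
  simp [eq_comm]

open scoped Classical in
theorem WeightLE.exists_eq_sum_le {μ ν : Module.Dual ℂ H} (h : WeightLE b μ ν) :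
    ∃ n : {i // b.IsPos i} → ℕ, ν - μ = ∑ i, n i • (IsKilling.rootSystem H).root i ∧
      ∑ i, (n i : ℝ) ≤ weightHeight b (ν - μ) := by
  obtain ⟨n, hn⟩ := h.exists_eq_sum
  refine ⟨n, hn, ?_⟩
  simp only [hn, map_sum, map_nsmul, nsmul_eq_mul]
  exact Finset.sum_le_sum fun i _ =>
    le_mul_of_one_le_right (Nat.cast_nonneg _) (one_le_weightHeight_root i.2)

theorem WeightLE.weightHeight_le {μ ν : Module.Dual ℂ H} (h : WeightLE b μ ν) :
    weightHeight b μ ≤ weightHeight b ν := by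
  classical
  obtain ⟨n, -, hn⟩ := h.exists_eq_sum_le
  rw [map_sub] at hn
  linarith [Finset.sum_nonneg fun i (_ : i ∈ Finset.univ) => Nat.cast_nonneg (α := ℝ) (n i)]

theorem weightHeight_lt_of_weightLE {i : H.root} (hi : b.IsPos i) {μ ν : Module.Dual ℂ H}
    (h : WeightLE b (i.1.toLinear + μ) ν) : weightHeight b μ < weightHeight b ν := by
  have hroot : 1 ≤ weightHeight b i.1.toLinear := one_le_weightHeight_root hi
  have := h.weightHeight_le
  rw [map_add] at this
  linarith

theorem finite_weightLE_interval (μ ν : Module.Dual ℂ H) :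
    {ξ | WeightLE b μ ξ ∧ WeightLE b ξ ν}.Finite := by
  classical
  obtain ⟨N, hN⟩ := exists_nat_ge (weightHeight b (ν - μ))
  refine ((Set.finite_Iic (fun _ : {i // b.IsPos i} => N)).image
    fun n => ∑ i, n i • (IsKilling.rootSystem H).root i.1 + μ).subset ?_
  rintro ξ ⟨hμξ, hξν⟩
  obtain ⟨n, hn, hn_le⟩ := hμξ.exists_eq_sum_le
  refine ⟨n, fun i => ?_, (congrArg (· + μ) hn).symm.trans (sub_add_cancel ξ μ)⟩
  have : (n i : ℝ) ≤ N := calc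
    (n i : ℝ) ≤ ∑ j, (n j : ℝ) :=
      Finset.single_le_sum (fun j _ => Nat.cast_nonneg (n j)) (Finset.mem_univ i)
    _ ≤ weightHeight b (ξ - μ) := hn_le
    _ ≤ weightHeight b (ν - μ) := by
      rw [map_sub, map_sub]; exact sub_le_sub_right hξν.weightHeight_le _
    _ ≤ N := hN
  exact_mod_cast this

end WeightOrder

/-! ### The triangular decomposition -/

section RootSpan

variable {𝔤 : Type*} [LieRing 𝔤] [LieAlgebra ℂ 𝔤] {H : LieSubalgebra ℂ 𝔤}
  [H.IsCartanSubalgebra]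

/-- The sum of the root spaces of the elements of a set of weights. -/
def rootSpan (s : Set (Module.Dual ℂ H)) : Submodule ℂ 𝔤 :=
  ⨆ α ∈ s, (rootSpace H (α : H → ℂ)).toSubmodule

theorem disjoint_rootSpan {s t : Set (Module.Dual ℂ H)} (hst : Disjoint s t) :
    Disjoint (rootSpan s) (rootSpan t) :=
  ((LieSubmodule.iSupIndep_toSubmodule.2 (iSupIndep_genWeightSpace ℂ H 𝔤)).comp
    DFunLike.coe_injective).disjoint_biSup_biSup hst

theorem rootSpace_le_rootSpan {s : Set (Module.Dual ℂ H)} {α : Module.Dual ℂ H} (hα : α ∈ s) :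
    (rootSpace H (α : H → ℂ)).toSubmodule ≤ rootSpan s :=
  le_biSup (fun α : Module.Dual ℂ H => (rootSpace H (α : H → ℂ)).toSubmodule) hα

variable [FiniteDimensional ℂ 𝔤]

theorem mem_rootSpace_zero_iff {x : 𝔤} : x ∈ rootSpace H (0 : H → ℂ) ↔ x ∈ H := by
  rw [rootSpace_zero_eq, LieSubalgebra.mem_toLieSubmodule]

theorem cartan_le_rootSpan {s : Set (Module.Dual ℂ H)} (hs : 0 ∈ s) :
    H.toSubmodule ≤ rootSpan s :=
  fun _ hx => rootSpace_le_rootSpan (α := 0) hs (mem_rootSpace_zero_iff.2 hx)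

end RootSpan

section TriangularDecomposition

variable {𝔤 : Type*} [LieRing 𝔤] [LieAlgebra ℂ 𝔤] [FiniteDimensional ℂ 𝔤]
  [LieAlgebra.IsSemisimple ℂ 𝔤] {H : LieSubalgebra ℂ 𝔤} [H.IsCartanSubalgebra]
  {b : (IsKilling.rootSystem H).Base}

/-- The sum `𝔫₊` of the root spaces of the positive roots. -/
def nPlus (b : (IsKilling.rootSystem H).Base) : Submodule ℂ 𝔤 :=
  ⨆ i : {i : H.root // b.IsPos i}, (rootSpace H (i.1.1 : H → ℂ)).toSubmodule

theorem rootSpace_le_nPlus {i : H.root} (hi : b.IsPos i) :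
    (rootSpace H (i.1 : H → ℂ)).toSubmodule ≤ nPlus b :=
  le_iSup (fun i : {i : H.root // b.IsPos i} => (rootSpace H (i.1.1 : H → ℂ)).toSubmodule) ⟨i, hi⟩

theorem rootSpace_neg_le_nMinus {i : H.root} (hi : b.IsPos i) :
    (rootSpace H (-(i.1 : H → ℂ))).toSubmodule ≤ (nMinus b).toSubmodule :=
  le_iSup (fun i : {i : H.root // b.IsPos i} => (rootSpace H (-(i.1.1 : H → ℂ))).toSubmodule)
    ⟨i, hi⟩

theorem nPlus_le_iff {p : Submodule ℂ 𝔤} :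
    nPlus b ≤ p ↔ ∀ i, b.IsPos i → (rootSpace H (i.1 : H → ℂ)).toSubmodule ≤ p := by
  rw [nPlus, iSup_le_iff, Subtype.forall]

theorem nMinus_le_iff {p : Submodule ℂ 𝔤} :
    (nMinus b).toSubmodule ≤ p ↔
      ∀ i, b.IsPos i → (rootSpace H (-(i.1 : H → ℂ))).toSubmodule ≤ p := by
  change ⨆ i : {i : H.root // b.IsPos i}, (rootSpace H (-(i.1.1 : H → ℂ))).toSubmodule ≤ p ↔ _
  rw [iSup_le_iff, Subtype.forall]

theorem weight_cases (b : (IsKilling.rootSystem H).Base) (α : Weight ℂ H 𝔤) :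
    (∃ i, b.IsPos i ∧ (α : H → ℂ) = -(i.1 : H → ℂ)) ∨ (α : H → ℂ) = 0 ∨
      ∃ i, b.IsPos i ∧ (α : H → ℂ) = i.1 := by
  by_cases h0 : (α : H → ℂ) = 0
  · exact Or.inr (Or.inl h0)
  let P := IsKilling.rootSystem H
  let _ := P.indexNeg
  let i : H.root := ⟨α, by simpa using h0⟩
  rcases RootPairing.Base.IsPos.or_neg b i with hi | hi
  · exact Or.inr (Or.inr ⟨i, hi, rfl⟩)
  · refine Or.inl ⟨-i, hi, funext fun h => ?_⟩
    have hroot : P.root (-i) = -P.root i := by simp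
    have : (-i).1 h = -α h := DFunLike.congr_fun hroot h
    rw [Pi.neg_apply, this, neg_neg]

theorem nMinus_sup_cartan_sup_nPlus (b : (IsKilling.rootSystem H).Base) :
    (nMinus b).toSubmodule ⊔ (H.toSubmodule ⊔ nPlus b) = ⊤ := by
  rw [← top_le_iff, ← LieSubmodule.top_toSubmodule (R := ℂ) (L := H),
    ← iSup_genWeightSpace_eq_top' ℂ H 𝔤, LieSubmodule.iSup_toSubmodule]
  refine iSup_le fun α => ?_
  rcases weight_cases b α with ⟨i, hi, h⟩ | h | ⟨i, hi, h⟩ <;> rw [h]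
  · exact (rootSpace_neg_le_nMinus hi).trans le_sup_left
  · exact le_sup_of_le_right (le_sup_of_le_left fun x hx => mem_rootSpace_zero_iff.1 hx)
  · exact (rootSpace_le_nPlus hi).trans (le_sup_right.trans le_sup_right)

theorem rootSpace_le_nPlus_of_weightHeight_pos {α : Module.Dual ℂ H} (hα : 0 < weightHeight b α) :
    (rootSpace H (α : H → ℂ)).toSubmodule ≤ nPlus b := by
  by_cases hbot : rootSpace H (α : H → ℂ) = ⊥
  · simp [hbot]
  rcases weight_cases b ⟨α, hbot⟩ with ⟨i, hi, h⟩ | h | ⟨i, hi, h⟩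
  · have hαi : α = -(IsKilling.rootSystem H).root i := DFunLike.coe_injective h
    rw [hαi, map_neg] at hα
    linarith [one_le_weightHeight_root hi]
  · have hα0 : α = 0 := DFunLike.coe_injective h
    simp [hα0] at hα
  · change (α : H → ℂ) = i.1 at h
    exact h ▸ rootSpace_le_nPlus hi

theorem nMinus_le_rootSpan {s : Set (Module.Dual ℂ H)} (hs : {α | weightHeight b α < 0} ⊆ s) :
    (nMinus b).toSubmodule ≤ rootSpan s := by
  refine nMinus_le_iff.2 fun i hi => rootSpace_le_rootSpan (α := -i.1.toLinear) (hs ?_)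
  have : 1 ≤ weightHeight b i.1.toLinear := one_le_weightHeight_root hi
  rw [Set.mem_ofPred_eq, map_neg]
  linarith

theorem nPlus_le_rootSpan {s : Set (Module.Dual ℂ H)} (hs : {α | 0 < weightHeight b α} ⊆ s) :
    nPlus b ≤ rootSpan s := by
  refine nPlus_le_iff.2 fun i hi => rootSpace_le_rootSpan (α := i.1.toLinear) (hs ?_)
  exact one_pos.trans_le (one_le_weightHeight_root hi)

theorem isCompl_nMinus (b : (IsKilling.rootSystem H).Base) :
    IsCompl (nMinus b).toSubmodule (H.toSubmodule ⊔ nPlus b) := by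
  have hneg : (nMinus b).toSubmodule ≤ rootSpan {α | weightHeight b α < 0} :=
    nMinus_le_rootSpan subset_rfl
  have hnonneg : H.toSubmodule ⊔ nPlus b ≤ rootSpan {α | 0 ≤ weightHeight b α} :=
    sup_le (cartan_le_rootSpan (by simp))
      (nPlus_le_rootSpan (Set.ofPred_subset_ofPred.2 fun _ => le_of_lt))
  have hdisj : Disjoint {α | weightHeight b α < 0} {α | 0 ≤ weightHeight b α} :=
    Set.disjoint_left.2 fun α hα => by simpa using hα
  exact ⟨(disjoint_rootSpan hdisj).mono hneg hnonneg,
    codisjoint_iff.2 (nMinus_sup_cartan_sup_nPlus b)⟩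

theorem isCompl_cartan (b : (IsKilling.rootSystem H).Base) :
    IsCompl H.toSubmodule ((nMinus b).toSubmodule ⊔ nPlus b) := by
  have hzero : H.toSubmodule ≤ rootSpan {0} := cartan_le_rootSpan rfl
  have hne : (nMinus b).toSubmodule ⊔ nPlus b ≤ rootSpan {α | weightHeight b α ≠ 0} :=
    sup_le (nMinus_le_rootSpan (Set.ofPred_subset_ofPred.2 fun _ => ne_of_lt))
      (nPlus_le_rootSpan (Set.ofPred_subset_ofPred.2 fun _ => ne_of_gt))
  have hdisj : Disjoint {0} {α | weightHeight b α ≠ 0} := by simp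
  refine ⟨(disjoint_rootSpan hdisj).mono hzero hne, codisjoint_iff.2 ?_⟩
  rw [sup_left_comm, nMinus_sup_cartan_sup_nPlus]

theorem lie_mem_nPlus {x y : 𝔤} (hx : x ∈ H.toSubmodule ⊔ nPlus b)
    (hy : y ∈ H.toSubmodule ⊔ nPlus b) : ⁅x, y⁆ ∈ nPlus b := by
  have cartan_nPlus {x y : 𝔤} (hx : x ∈ H) (hy : y ∈ nPlus b) : ⁅x, y⁆ ∈ nPlus b := by
    refine (nPlus_le_iff (p := (nPlus b).comap (ad ℂ 𝔤 x))).2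
      (fun i hi y hy => ?_) hy
    exact rootSpace_le_nPlus hi ((rootSpace H i.1).lie_mem (x := (⟨x, hx⟩ : H)) hy)
  have nPlus_nPlus {x y : 𝔤} (hx : x ∈ nPlus b) (hy : y ∈ nPlus b) : ⁅x, y⁆ ∈ nPlus b := by
    rw [← lie_skew, neg_mem_iff]
    refine (nPlus_le_iff (p := (nPlus b).comap (ad ℂ 𝔤 y))).2 (fun i hi x hx => ?_) hx
    change ⁅y, x⁆ ∈ nPlus b
    rw [← lie_skew, neg_mem_iff]
    refine (nPlus_le_iff (p := (nPlus b).comap (ad ℂ 𝔤 x))).2 (fun j hj y hy => ?_) hy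
    refine rootSpace_le_nPlus_of_weightHeight_pos (α := i.1.toLinear + j.1.toLinear) ?_
      (lie_mem_genWeightSpace_of_mem_genWeightSpace hx hy)
    rw [map_add]
    exact add_pos (one_pos.trans_le (one_le_weightHeight_root hi))
      (one_pos.trans_le (one_le_weightHeight_root hj))
  obtain ⟨h, hh, x, hxn, rfl⟩ := mem_sup.1 hx
  obtain ⟨h', hh', y, hyn, rfl⟩ := mem_sup.1 hy
  have cartan_comm : ⁅h, h'⁆ = 0 := by
    simpa using IsKilling.lie_eq_smul_of_mem_rootSpace (mem_rootSpace_zero_iff.2 hh') ⟨h, hh⟩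
  rw [add_lie, lie_add, lie_add, cartan_comm, zero_add, ← lie_skew x h']
  exact add_mem (cartan_nPlus hh hyn)
    (add_mem (neg_mem (cartan_nPlus hh' hxn)) (nPlus_nPlus hxn hyn))

/-- The linear map `𝔤 → U(𝔫₋)` that is the inclusion on `𝔫₋`, the weight `wt` on `𝔥` and zero
on `𝔫₊`. It is the orbit map `x ↦ x * 1` of the action on `U(𝔫₋) ≅ Δ(wt)`. -/
def vermaOrbitMap (b : (IsKilling.rootSystem H).Base) (wt : Module.Dual ℂ H) :
    𝔤 →ₗ[ℂ] 𝒰 ℂ (nMinus b) :=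
  letI := LieRing.ofAssociativeRing (A := 𝒰 ℂ (nMinus b))
  (ι ℂ : nMinus b →ₗ⁅ℂ⁆ 𝒰 ℂ (nMinus b)).toLinearMap ∘ₗ projectionOnto _ _ (isCompl_nMinus b) +
    (wt ∘ₗ projectionOnto _ _ (isCompl_cartan b)).smulRight 1

theorem vermaOrbitMap_of_mem (wt : Module.Dual ℂ H) {x : 𝔤} (hx : x ∈ H.toSubmodule ⊔ nPlus b) :
    vermaOrbitMap b wt x = wt (projectionOnto _ _ (isCompl_cartan b) x) • 1 := by
  let _ := LieRing.ofAssociativeRing (A := 𝒰 ℂ (nMinus b))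
  change (ι ℂ : nMinus b →ₗ⁅ℂ⁆ _) (projectionOnto _ _ (isCompl_nMinus b) x) + _ = _
  rw [(projectionOnto_apply_eq_zero_iff (isCompl_nMinus b)).2 hx, map_zero, zero_add]
  rfl

theorem vermaOrbitMap_cartan (wt : Module.Dual ℂ H) (h : H) :
    vermaOrbitMap b wt h = wt h • 1 := by
  rw [vermaOrbitMap_of_mem wt (mem_sup_left h.2)]
  congr 2
  exact projectionOnto_apply_left (isCompl_cartan b) h

theorem vermaOrbitMap_nPlus (wt : Module.Dual ℂ H) {x : 𝔤} (hx : x ∈ nPlus b) :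
    vermaOrbitMap b wt x = 0 := by
  rw [vermaOrbitMap_of_mem wt (mem_sup_right hx),
    (projectionOnto_apply_eq_zero_iff (isCompl_cartan b)).2 (mem_sup_right hx), map_zero, zero_smul]

theorem vermaOrbitMap_nMinus (wt : Module.Dual ℂ H) (y : nMinus b) :
    vermaOrbitMap b wt y = ι ℂ y := by
  have hι : projectionOnto _ _ (isCompl_nMinus b) (y : 𝔤) = y :=
    projectionOnto_apply_left (isCompl_nMinus b) y
  have hwt : projectionOnto _ _ (isCompl_cartan b) (y : 𝔤) = 0 :=
    (projectionOnto_apply_eq_zero_iff (isCompl_cartan b)).2 (mem_sup_left y.2)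
  let _ := LieRing.ofAssociativeRing (A := 𝒰 ℂ (nMinus b))
  change (ι ℂ : nMinus b →ₗ⁅ℂ⁆ _) (projectionOnto _ _ (isCompl_nMinus b) (y : 𝔤)) +
    wt (projectionOnto _ _ (isCompl_cartan b) (y : 𝔤)) • 1 = ι ℂ y
  rw [hι, hwt, map_zero, zero_smul, add_zero]

theorem extendsByCharacter_vermaOrbitMap (b : (IsKilling.rootSystem H).Base)
    (wt : Module.Dual ℂ H) :
    ExtendsByCharacter (vermaOrbitMap b wt) (H.toSubmodule ⊔ nPlus b) where
  sup_eq_top := nMinus_sup_cartan_sup_nPlus b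
  apply_coe := vermaOrbitMap_nMinus wt
  exists_apply_eq_smul_one _ hx := ⟨_, vermaOrbitMap_of_mem wt hx⟩
  apply_lie _ hx _ hy := vermaOrbitMap_nPlus wt (lie_mem_nPlus hx hy)

end TriangularDecomposition

/-! ### Weight spaces -/

section WeightSpaces

variable {𝔤 : Type*} [LieRing 𝔤] [LieAlgebra ℂ 𝔤] {H : LieSubalgebra ℂ 𝔤}
  {M : Type*} [AddCommGroup M] [Module ℂ M] [LieRingModule 𝔤 M] [LieModule ℂ 𝔤 M]
  {M' : Type*} [AddCommGroup M'] [Module ℂ M'] [LieRingModule 𝔤 M'] [LieModule ℂ 𝔤 M']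
  {μ ν : Module.Dual ℂ H}

variable (H M) in
/-- The weight space `M_μ`, as a complex subspace of `M`. -/
def wtSpace (μ : Module.Dual ℂ H) : Submodule ℂ M :=
  (weightSpace M (μ : H → ℂ) : LieSubmodule ℂ H M).toSubmodule

theorem mem_wtSpace {m : M} : m ∈ wtSpace H M μ ↔ ∀ h : H, ⁅(h : 𝔤), m⁆ = μ h • m :=
  mem_weightSpace (μ : H → ℂ) m

theorem isWeightModule_iff : IsWeightModule H M ↔ ⨆ μ, wtSpace H M μ = ⊤ := by
  rw [IsWeightModule, ← LieSubmodule.toSubmodule_inj, LieSubmodule.iSup_toSubmodule]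
  rfl

theorem map_mem_wtSpace (f : M →ₗ⁅ℂ,𝔤⁆ M') {m : M} (hm : m ∈ wtSpace H M μ) :
    f m ∈ wtSpace H M' μ :=
  mem_wtSpace.2 fun h => by rw [← LieModuleHom.map_lie, mem_wtSpace.1 hm h, map_smul]

theorem tmul_mem_wtSpace {m : M} {x : M'} (hm : m ∈ wtSpace H M μ) (hx : x ∈ wtSpace H M' ν) :
    m ⊗ₜ[ℂ] x ∈ wtSpace H (M ⊗[ℂ] M') (μ + ν) := by
  refine mem_wtSpace.2 fun h => ?_
  rw [TensorProduct.LieModule.lie_tmul_right, mem_wtSpace.1 hm h, mem_wtSpace.1 hx h,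
    LinearMap.add_apply, add_smul, TensorProduct.tmul_smul, ← TensorProduct.smul_tmul']

variable [H.IsCartanSubalgebra]

variable (H M) in
theorem iSupIndep_wtSpace : iSupIndep (wtSpace H M) :=
  (LieSubmodule.iSupIndep_toSubmodule.2 ((iSupIndep_genWeightSpace ℂ H M).comp
    DFunLike.coe_injective)).mono fun μ => weightSpace_le_genWeightSpace M (μ : H → ℂ)

theorem exists_mem_wtSpace_apply_eq {f : M →ₗ⁅ℂ,𝔤⁆ M'} (hf : Function.Surjective f)
    (hM : IsWeightModule H M) {m' : M'} (hm' : m' ∈ wtSpace H M' μ) :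
    ∃ m ∈ wtSpace H M μ, f m = m' := by
  have map_le (μ) : (wtSpace H M μ).map (f : M →ₗ[ℂ] M') ≤ wtSpace H M' μ := by
    rintro _ ⟨m, hm, rfl⟩
    exact map_mem_wtSpace f hm
  have iSup_map : ⨆ μ, (wtSpace H M μ).map (f : M →ₗ[ℂ] M') = ⊤ := by
    rw [← Submodule.map_iSup, isWeightModule_iff.1 hM, Submodule.map_top, LinearMap.range_eq_top]
    exact hf
  have map_eq := ((iSupIndep_wtSpace H M').le_iff_eq_of_iSup_eq_top iSup_map).1 map_le
  exact Submodule.mem_map.1 (congrFun map_eq μ ▸ hm')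

theorem lie_mem_wtSpace [FiniteDimensional ℂ 𝔤] [LieAlgebra.IsSemisimple ℂ 𝔤]
    {α : Module.Dual ℂ H} {x : 𝔤} {m : M} (hx : x ∈ rootSpace H (α : H → ℂ))
    (hm : m ∈ wtSpace H M μ) : ⁅x, m⁆ ∈ wtSpace H M (α + μ) := by
  refine mem_wtSpace.2 fun h => ?_
  rw [leibniz_lie, mem_wtSpace.1 hm h, ← LieSubalgebra.coe_bracket_of_module,
    IsKilling.lie_eq_smul_of_mem_rootSpace hx h, smul_lie, lie_smul, LinearMap.add_apply, add_smul]

end WeightSpaces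

section LieOrbitMap

variable {R L M : Type*} [CommRing R] [LieRing L] [LieAlgebra R L] [AddCommGroup M] [Module R M]
  [LieRingModule L M] [LieModule R L M]

variable (R L) in
/-- The linear map `x ↦ ⁅x, m⁆`. -/
def lieOrbitMap (m : M) : L →ₗ[R] M where
  toFun x := ⁅x, m⁆
  map_add' x y := add_lie x y m
  map_smul' c x := smul_lie c x m

@[simp] theorem lieOrbitMap_apply (m : M) (x : L) : lieOrbitMap R L m x = ⁅x, m⁆ := rfl

end LieOrbitMap

/-! ### Weight vectors that generate over `U(𝔫₋)` -/

section Generators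

attribute [local instance] envModule envModule_isScalarTower

theorem lie_mem_span_env {L : Type*} [LieRing L] [LieAlgebra ℂ L] {M : Type*} [AddCommGroup M]
    [Module ℂ M] [LieRingModule L M] [LieModule ℂ L M] {n : LieSubalgebra ℂ L} {S : Set M}
    (hS : ∀ m ∈ S, ∀ x : L, ⁅x, m⁆ ∈ span (𝒰 ℂ n) S) (x : L) {m : M} (hm : m ∈ span (𝒰 ℂ n) S) :
    ⁅x, m⁆ ∈ span (𝒰 ℂ n) S := by
  set P := span (𝒰 ℂ n) S
  let q : Submodule ℂ M :=
    P.restrictScalars ℂ ⊓ ⨅ x : L, (P.restrictScalars ℂ).comap (toEnd ℂ L M x)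
  have mem_q {m : M} : m ∈ q ↔ m ∈ P ∧ ∀ x : L, ⁅x, m⁆ ∈ P := by simp [q]
  refine (mem_q.1 (mem_of_mem_span_of_lie_mem (L := n) (fun y m hm => mem_q.2 ?_)
    (fun s hs => mem_q.2 ⟨subset_span hs, hS s hs⟩) hm)).2 x
  refine ⟨lie_mem_of_mem P y (mem_q.1 hm).1, fun x => ?_⟩
  rw [LieSubalgebra.coe_bracket_of_module, leibniz_lie]
  exact P.add_mem ((mem_q.1 hm).2 _) (lie_mem_of_mem P y ((mem_q.1 hm).2 x))

variable {𝔤 : Type*} [LieRing 𝔤] [LieAlgebra ℂ 𝔤] [FiniteDimensional ℂ 𝔤]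
  [LieAlgebra.IsSemisimple ℂ 𝔤] {H : LieSubalgebra ℂ 𝔤} [H.IsCartanSubalgebra]
  {b : (IsKilling.rootSystem H).Base}
  {M : Type*} [AddCommGroup M] [Module ℂ M] [LieRingModule 𝔤 M] [LieModule ℂ 𝔤 M]
  {I : Type*} {v : I → M} {κ : I → Module.Dual ℂ H}

theorem nMinus_lie_mem {p : Submodule ℂ M}
    (hp : ∀ i, b.IsPos i → ∀ x ∈ rootSpace H (-(i.1 : H → ℂ)), ∀ m ∈ p, ⁅x, m⁆ ∈ p)
    (y : nMinus b) {m : M} (hm : m ∈ p) : ⁅y, m⁆ ∈ p :=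
  (nMinus_le_iff (p := p.comap (lieOrbitMap ℂ 𝔤 m))).2 (fun i hi x hx => hp i hi x hx m hm) y.2

theorem lie_mem_of_nPlus_lie_mem {P : Submodule (𝒰 ℂ (nMinus b)) M} {μ : Module.Dual ℂ H} {m : M}
    (hm : m ∈ P) (hwt : m ∈ wtSpace H M μ) (hpos : ∀ x ∈ nPlus b, ⁅x, m⁆ ∈ P) (x : 𝔤) :
    ⁅x, m⁆ ∈ P := by
  have le_comap : (nMinus b).toSubmodule ⊔ (H.toSubmodule ⊔ nPlus b) ≤
      (P.restrictScalars ℂ).comap (lieOrbitMap ℂ 𝔤 m) := by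
    refine sup_le (fun y hy => ?_) (sup_le (fun h hh => ?_) hpos)
    · exact lie_mem_of_mem P (⟨y, hy⟩ : nMinus b) hm
    · change ⁅h, m⁆ ∈ P.restrictScalars ℂ
      rw [mem_wtSpace.1 hwt ⟨h, hh⟩]
      exact (P.restrictScalars ℂ).smul_mem _ hm
  exact le_comap (nMinus_sup_cartan_sup_nPlus b ▸ mem_top)

/-- The vectors `v i` of weight `κ i` generate `M` over `U(𝔫₋)`. -/
structure IsWeightGenerating (b : (IsKilling.rootSystem H).Base) (v : I → M)
    (κ : I → Module.Dual ℂ H) : Prop where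
  mem_wtSpace : ∀ i, v i ∈ wtSpace H M (κ i)
  span_eq_top : span (𝒰 ℂ (nMinus b)) (Set.range v) = ⊤

/-- The vectors `v i` of weight `κ i` form a basis of `M` over `U(𝔫₋)`. -/
structure IsWeightBasis (b : (IsKilling.rootSystem H).Base) (v : I → M)
    (κ : I → Module.Dual ℂ H) : Prop extends IsWeightGenerating b v κ where
  linearIndependent : LinearIndependent (𝒰 ℂ (nMinus b)) v

theorem iSup_eq_top_of_nMinus_lie_mem (hv : IsWeightGenerating b v κ)
    {g : Module.Dual ℂ H → Submodule ℂ M} (hg : ∀ i, v i ∈ g (κ i))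
    (hlie : ∀ i, b.IsPos i → ∀ x ∈ rootSpace H (-(i.1 : H → ℂ)), ∀ ν, ∀ m ∈ g ν,
      ⁅x, m⁆ ∈ g (-i.1.toLinear + ν)) : ⨆ ν, g ν = ⊤ := by
  have stable : ∀ y : nMinus b, ∀ m ∈ ⨆ ν, g ν, ⁅y, m⁆ ∈ ⨆ ν, g ν := by
    refine fun y m hm => nMinus_lie_mem (fun i hi x hx m hm => ?_) y hm
    have : ⨆ ν, g ν ≤ (⨆ ν, g ν).comap (toEnd ℂ 𝔤 M x) :=
      iSup_le fun ν m hm => mem_iSup_of_mem _ (hlie i hi x hx ν m hm)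
    exact this hm
  refine eq_top_iff.2 fun m _ => mem_of_mem_span_of_lie_mem stable ?_
    (hv.span_eq_top ▸ mem_top : m ∈ span (𝒰 ℂ (nMinus b)) (Set.range v))
  exact Set.range_subset_iff.2 fun i => mem_iSup_of_mem (κ i) (hg i)

namespace IsWeightGenerating

theorem isWeightModule (hv : IsWeightGenerating b v κ) : IsWeightModule H M :=
  isWeightModule_iff.2 <| iSup_eq_top_of_nMinus_lie_mem hv hv.mem_wtSpace
    fun i _ _ hx _ _ hm => lie_mem_wtSpace (α := -i.1.toLinear) hx hm

theorem mem_span_of_mem_wtSpace (hv : IsWeightGenerating b v κ) {μ : Module.Dual ℂ H} {m : M}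
    (hm : m ∈ wtSpace H M μ) :
    m ∈ span (𝒰 ℂ (nMinus b)) (v '' {i | WeightLE b μ (κ i)}) := by
  let P (ν) := span (𝒰 ℂ (nMinus b)) (v '' {i | WeightLE b ν (κ i)})
  have P_anti {ν ξ} (h : WeightLE b ν ξ) : P ξ ≤ P ν :=
    span_mono (Set.image_mono fun i hi => h.trans hi)
  let g (ν) := (P ν).restrictScalars ℂ ⊓ wtSpace H M ν
  have iSup_g : ⨆ ν, g ν = ⊤ := by
    refine iSup_eq_top_of_nMinus_lie_mem hv (fun i => ?_) fun i hi x hx ν m hm => ?_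
    · exact ⟨subset_span ⟨i, weightLE_refl _, rfl⟩, hv.mem_wtSpace i⟩
    · refine ⟨P_anti (weightLE_sub_root hi ν) ?_,
        lie_mem_wtSpace (α := -i.1.toLinear) hx hm.2⟩
      exact lie_mem_of_mem (P ν) (⟨x, rootSpace_neg_le_nMinus hi hx⟩ : nMinus b) hm.1
  have g_eq := ((iSupIndep_wtSpace H M).le_iff_eq_of_iSup_eq_top iSup_g).1 fun _ => inf_le_right
  rw [← congrFun g_eq μ] at hm
  exact hm.1

theorem inO [Finite I] (hv : IsWeightGenerating b v κ) : InO b M :=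
  ⟨hv.isWeightModule, Module.finite_def.2 (hv.span_eq_top ▸ fg_span (Set.finite_range v))⟩

theorem nPlus_lie_mem (hv : IsWeightGenerating b v κ) {s : Set I} {i : I}
    (hs : ∀ j, b.IsPos j → ∀ l, WeightLE b (j.1.toLinear + κ i) (κ l) → l ∈ s) {x : 𝔤}
    (hx : x ∈ nPlus b) : ⁅x, v i⁆ ∈ span (𝒰 ℂ (nMinus b)) (v '' s) := by
  have le_comap : nPlus b ≤ ((span (𝒰 ℂ (nMinus b)) (v '' s)).restrictScalars ℂ).comap
      (lieOrbitMap ℂ 𝔤 (v i)) := by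
    refine nPlus_le_iff.2 fun j hj x hx => ?_
    refine span_mono (Set.image_mono fun l hl => hs j hj l hl)
      (hv.mem_span_of_mem_wtSpace (μ := j.1.toLinear + κ i) ?_)
    exact lie_mem_wtSpace (α := j.1.toLinear) hx (hv.mem_wtSpace i)
  exact le_comap hx

/-- The `𝔤`-submodule generated over `U(𝔫₋)` by a set of generators, if this set contains all
generators of weight at least `α + κ i` for each positive root `α` and each `i` in it. -/
def spanLie (hv : IsWeightGenerating b v κ) (s : Set I)
    (hs : ∀ i ∈ s, ∀ j, b.IsPos j → ∀ l, WeightLE b (j.1.toLinear + κ i) (κ l) → l ∈ s) :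
    LieSubmodule ℂ 𝔤 M where
  toSubmodule := (span (𝒰 ℂ (nMinus b)) (v '' s)).restrictScalars ℂ
  lie_mem {x m} hm := by
    refine lie_mem_span_env (S := v '' s) ?_ x hm
    rintro _ ⟨i, hi, rfl⟩
    exact lie_mem_of_nPlus_lie_mem (subset_span ⟨i, hi, rfl⟩) (hv.mem_wtSpace i) fun x hx =>
      hv.nPlus_lie_mem (hs i hi) hx

theorem mem_spanLie {hv : IsWeightGenerating b v κ} {s : Set I}
    {hs : ∀ i ∈ s, ∀ j, b.IsPos j → ∀ l, WeightLE b (j.1.toLinear + κ i) (κ l) → l ∈ s} {m : M} :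
    m ∈ hv.spanLie s hs ↔ m ∈ span (𝒰 ℂ (nMinus b)) (v '' s) := Iff.rfl

theorem mem_truncSubmodule_iff (hv : IsWeightGenerating b v κ) (wt : Module.Dual ℂ H) {m : M} :
    m ∈ truncSubmodule b wt M ↔
      m ∈ span (𝒰 ℂ (nMinus b)) (v '' {i | ¬ WeightLE b (κ i) wt}) := by
  have isUpper : ∀ i ∈ {i | ¬ WeightLE b (κ i) wt}, ∀ j, b.IsPos j →
      ∀ l, WeightLE b (j.1.toLinear + κ i) (κ l) → l ∈ {i | ¬ WeightLE b (κ i) wt} :=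
    fun i hi j hj l hl hl' => hi ((weightLE_add_root hj (κ i)).trans (hl.trans hl'))
  have trunc_le : truncSubmodule b wt M ≤ hv.spanLie _ isUpper := by
    rw [truncSubmodule, LieSubmodule.lieSpan_le]
    rintro m ⟨μ, hμ, hm⟩
    have subset : {i | WeightLE b μ (κ i)} ⊆ {i | ¬ WeightLE b (κ i) wt} :=
      Set.ofPred_subset_ofPred.2 fun i hi hi' => hμ (hi.trans hi')
    exact mem_spanLie.2 (span_mono (Set.image_mono subset) (hv.mem_span_of_mem_wtSpace hm))
  have le_trunc : span (𝒰 ℂ (nMinus b)) (v '' {i | ¬ WeightLE b (κ i) wt}) ≤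
      envSubmodule (nMinus b) (truncSubmodule b wt M) := by
    refine span_le.2 ?_
    rintro _ ⟨i, hi, rfl⟩
    exact mem_envSubmodule.2 (LieSubmodule.subset_lieSpan ⟨κ i, hi, hv.mem_wtSpace i⟩)
  exact ⟨fun hm => mem_spanLie.1 (trunc_le hm), fun hm => mem_envSubmodule.1 (le_trunc hm)⟩

end IsWeightGenerating

theorem IsWeightBasis.envFree (hv : IsWeightBasis b v κ) : EnvFree (nMinus b) M :=
  Module.Free.of_basis (Module.Basis.mk hv.linearIndependent hv.span_eq_top.ge)

theorem InO.exists_isWeightGenerating (hM : InO b M) :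
    ∃ (s : Finset M) (κ : s → Module.Dual ℂ H), IsWeightGenerating b ((↑) : s → M) κ := by
  let weightVectors : Set M := {m | ∃ μ, m ∈ wtSpace H M μ}
  have span_weightVectors : span (𝒰 ℂ (nMinus b)) weightVectors = ⊤ := by
    have iSup_le : ⨆ μ, wtSpace H M μ ≤
        (span (𝒰 ℂ (nMinus b)) weightVectors).restrictScalars ℂ :=
      iSup_le fun μ m hm => subset_span ⟨μ, hm⟩
    rw [isWeightModule_iff.1 hM.isWeightModule] at iSup_le
    exact eq_top_iff'.2 fun m => iSup_le mem_top
  have fg_top : (⊤ : Submodule (𝒰 ℂ (nMinus b)) M).FG := Module.finite_def.1 hM.finite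
  rw [← span_weightVectors, fg_span_iff_fg_span_finset_subset] at fg_top
  obtain ⟨s, hs, span_s⟩ := fg_top
  choose κ hκ using fun m : s => hs m.2
  exact ⟨s, κ, hκ, by rw [Subtype.range_coe, ← span_weightVectors]; exact span_s.symm⟩

section Truncation

variable (b M) in
/-- The quotient map `M → M^{≤ wt}`, as a map of `U(𝔫₋)`-modules. -/
def truncMk (wt : Module.Dual ℂ H) : M →ₗ[𝒰 ℂ (nMinus b)] Trunc b wt M :=
  envHom ((LieSubmodule.Quotient.mk' (truncSubmodule b wt M)).restrictLie (nMinus b))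

theorem truncMk_eq_zero_iff {wt : Module.Dual ℂ H} {m : M} :
    truncMk b M wt m = 0 ↔ m ∈ truncSubmodule b wt M :=
  LieSubmodule.Quotient.mk_eq_zero _

theorem IsWeightGenerating.trunc (hv : IsWeightGenerating b v κ) (wt : Module.Dual ℂ H) :
    IsWeightGenerating b (fun i : {i // WeightLE b (κ i) wt} => truncMk b M wt (v i))
      (fun i => κ i) where
  mem_wtSpace i := map_mem_wtSpace (LieSubmodule.Quotient.mk' _) (hv.mem_wtSpace i)
  span_eq_top := by
    have surjective : Function.Surjective (truncMk b M wt) :=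
      LieSubmodule.Quotient.surjective_mk' _
    rw [eq_top_iff, ← LinearMap.range_eq_top.2 surjective, ← Submodule.map_top, ← hv.span_eq_top,
      map_span, span_le]
    rintro _ ⟨_, ⟨i, rfl⟩, rfl⟩
    by_cases hi : WeightLE b (κ i) wt
    · exact subset_span ⟨⟨i, hi⟩, rfl⟩
    · rw [truncMk_eq_zero_iff.2 (LieSubmodule.subset_lieSpan ⟨κ i, hi, hv.mem_wtSpace i⟩)]
      exact zero_mem _

theorem IsWeightBasis.trunc (hv : IsWeightBasis b v κ) (wt : Module.Dual ℂ H) :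
    IsWeightBasis b (fun i : {i // WeightLE b (κ i) wt} => truncMk b M wt (v i))
      (fun i => κ i) where
  toIsWeightGenerating := hv.toIsWeightGenerating.trunc wt
  linearIndependent := by
    have ker_truncMk : LinearMap.ker (truncMk b M wt) =
        span (𝒰 ℂ (nMinus b)) (v '' {i | ¬ WeightLE b (κ i) wt}) := by
      ext m
      rw [← hv.mem_truncSubmodule_iff wt, LinearMap.mem_ker, truncMk_eq_zero_iff]
    refine (hv.linearIndependent.comp _ Subtype.val_injective).map (f := truncMk b M wt) ?_
    rw [ker_truncMk, Set.range_comp, Subtype.range_coe_subtype]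
    exact hv.linearIndependent.disjoint_span_image
      (Set.disjoint_left.2 fun i hi hi' => hi' hi)

end Truncation

section Tensor

variable {X : Type*} [AddCommGroup X] [Module ℂ X] [LieRingModule 𝔤 X] [LieModule ℂ 𝔤 X]
  {J : Type*} {c : J → X} {κ' : J → Module.Dual ℂ H}

theorem IsWeightGenerating.tmul (hv : IsWeightGenerating b v κ)
    (hc : ∀ j, c j ∈ wtSpace H X (κ' j)) (hspan : span ℂ (Set.range c) = ⊤) :
    IsWeightGenerating b (fun p : I × J => v p.1 ⊗ₜ[ℂ] c p.2) (fun p => κ p.1 + κ' p.2) :=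
  ⟨fun p => tmul_mem_wtSpace (hv.mem_wtSpace p.1) (hc p.2),
    span_tmul_eq_top hv.span_eq_top hspan⟩

theorem IsWeightBasis.tmul (hv : IsWeightBasis b v κ) (hc : ∀ j, c j ∈ wtSpace H X (κ' j))
    (hspan : span ℂ (Set.range c) = ⊤) (hli : LinearIndependent ℂ c) :
    IsWeightBasis b (fun p : I × J => v p.1 ⊗ₜ[ℂ] c p.2) (fun p => κ p.1 + κ' p.2) :=
  ⟨hv.toIsWeightGenerating.tmul hc hspan,
    linearIndependent_tmul hv.linearIndependent hv.span_eq_top hli⟩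

end Tensor

end Generators

/-! ### Verma modules -/

section VermaModules

attribute [local instance] envModule envModule_isScalarTower

variable {𝔤 : Type*} [LieRing 𝔤] [LieAlgebra ℂ 𝔤] [FiniteDimensional ℂ 𝔤]
  [LieAlgebra.IsSemisimple ℂ 𝔤] {H : LieSubalgebra ℂ 𝔤} [H.IsCartanSubalgebra]
  {b : (IsKilling.rootSystem H).Base} {wt : Module.Dual ℂ H}
  {Q : Type*} [AddCommGroup Q] [Module ℂ Q] [LieRingModule 𝔤 Q] [LieModule ℂ 𝔤 Q]
  {Q' : Type*} [AddCommGroup Q'] [Module ℂ Q'] [LieRingModule 𝔤 Q'] [LieModule ℂ 𝔤 Q']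
  {q : Q}

theorem smul_eq_zero_of_mem_vermaIdeal {N : Type*} [AddCommGroup N] [Module (𝒰 ℂ 𝔤) N] {m : N}
    (hH : ∀ h : H, ι ℂ (h : 𝔤) • m = algebraMap ℂ (𝒰 ℂ 𝔤) (wt h) • m)
    (hpos : ∀ x ∈ nPlus b, ι ℂ x • m = 0) {u : 𝒰 ℂ 𝔤} (hu : u ∈ vermaIdeal b wt) :
    u • m = 0 := by
  have le_ker : vermaIdeal b wt ≤ LinearMap.ker (LinearMap.toSpanSingleton (𝒰 ℂ 𝔤) N m) := by
    refine span_le.2 ?_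
    rintro _ (⟨i, hi, x, hx, rfl⟩ | ⟨h, rfl⟩)
    · exact hpos x (rootSpace_le_nPlus hi hx)
    · change (ι ℂ (h : 𝔤) - algebraMap ℂ (𝒰 ℂ 𝔤) (wt h)) • m = 0
      rw [sub_smul, hH, sub_self]
  exact le_ker hu

/-- `q` is a highest weight vector of weight `wt` that generates `Q` freely over `U(𝔫₋)`. -/
structure IsVermaGenerator (b : (IsKilling.rootSystem H).Base) (wt : Module.Dual ℂ H) (q : Q) :
    Prop where
  mem_wtSpace : q ∈ wtSpace H Q wt
  nPlus_lie : ∀ x ∈ nPlus b, ⁅x, q⁆ = 0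
  span_eq_top : span (𝒰 ℂ (nMinus b)) {q} = ⊤
  eq_zero_of_smul_eq_zero : ∀ u : 𝒰 ℂ (nMinus b), u • q = 0 → u = 0

namespace Verma

variable (b wt) in
/-- The quotient map `U(𝔤) → Δ(wt)`. -/
def mk : 𝒰 ℂ 𝔤 →ₗ[ℂ] Verma b wt := (vermaIdeal b wt).mkQ.restrictScalars ℂ

theorem mk_eq_zero {u : 𝒰 ℂ 𝔤} : mk b wt u = 0 ↔ u ∈ vermaIdeal b wt :=
  Submodule.Quotient.mk_eq_zero _

theorem mk_ι_mul (x : 𝔤) (u : 𝒰 ℂ 𝔤) : mk b wt (ι ℂ x * u) = ⁅x, mk b wt u⁆ := rfl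

variable (b wt) in
/-- The canonical generator of a Verma module. -/
def gen : Verma b wt := mk b wt 1

theorem lie_gen (x : 𝔤) : ⁅x, gen b wt⁆ = mk b wt (ι ℂ x) := by
  rw [gen, ← mk_ι_mul, mul_one]

theorem mk_envIncl (u : 𝒰 ℂ (nMinus b)) : mk b wt (envIncl (nMinus b) u) = u • gen b wt := by
  induction u using env_induction with
  | one => rw [map_one, one_smul, gen]
  | add u v hu hv => rw [map_add, map_add, hu, hv, add_smul]
  | smul c u hu => rw [map_smul, map_smul, hu, smul_assoc]
  | mul y u hu =>
    rw [map_mul, envIncl_ι, mk_ι_mul, hu, mul_smul, ι_smul, LieSubalgebra.coe_bracket_of_module]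

theorem gen_mem_wtSpace : gen b wt ∈ wtSpace H (Verma b wt) wt := by
  refine mem_wtSpace.2 fun h => ?_
  rw [lie_gen, ← sub_eq_zero, gen, ← map_smul, ← map_sub, mk_eq_zero,
    ← Algebra.algebraMap_eq_smul_one]
  exact subset_span (Or.inr ⟨h, rfl⟩)

theorem lie_gen_eq_zero {x : 𝔤} (hx : x ∈ nPlus b) : ⁅x, gen b wt⁆ = 0 := by
  have le_ker : nPlus b ≤ LinearMap.ker (lieOrbitMap ℂ 𝔤 (gen b wt)) := by
    refine nPlus_le_iff.2 fun i hi x hx => ?_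
    rw [LinearMap.mem_ker, lieOrbitMap_apply, lie_gen, mk_eq_zero]
    exact subset_span (Or.inl ⟨i, hi, x, hx, rfl⟩)
  exact le_ker hx

theorem span_nMinus_gen_eq_top : span (𝒰 ℂ (nMinus b)) {gen b wt} = ⊤ := by
  have lie_gen_mem : ∀ m ∈ ({gen b wt} : Set (Verma b wt)), ∀ x : 𝔤,
      ⁅x, m⁆ ∈ span (𝒰 ℂ (nMinus b)) {gen b wt} := by
    rintro _ rfl
    refine lie_mem_of_nPlus_lie_mem (mem_span_singleton_self _) gen_mem_wtSpace fun x hx => ?_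
    rw [lie_gen_eq_zero hx]
    exact zero_mem _
  refine eq_top_iff.2 fun m _ => ?_
  obtain ⟨u, rfl⟩ := (vermaIdeal b wt).mkQ_surjective m
  have mk_eq : mk b wt u = u • gen b wt := congrArg (mk b wt) (mul_one u).symm
  refine (mk_eq ▸ smul_mem_of_ι_smul_mem
    (p := (span (𝒰 ℂ (nMinus b)) {gen b wt}).restrictScalars ℂ)
    (fun x _ => lie_mem_span_env lie_gen_mem x) u (mem_span_singleton_self _) : mk b wt u ∈ _)

theorem eq_zero_of_smul_gen_eq_zero {u : 𝒰 ℂ (nMinus b)} (hu : u • gen b wt = 0) : u = 0 := by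
  let hφ := extendsByCharacter_vermaOrbitMap b wt
  let _ : Module (𝒰 ℂ 𝔤) (𝒰 ℂ (nMinus b)) := Module.compHom _ hφ.action.toRingHom
  have smul_def (v : 𝒰 ℂ 𝔤) (w : 𝒰 ℂ (nMinus b)) : v • w = hφ.action v w := rfl
  rw [← mk_envIncl, mk_eq_zero] at hu
  have smul_one_eq_zero : envIncl (nMinus b) u • (1 : 𝒰 ℂ (nMinus b)) = 0 := by
    refine smul_eq_zero_of_mem_vermaIdeal (fun h => ?_) (fun x hx => ?_) hu
    · rw [smul_def, smul_def, hφ.action_ι, inducedMap_one, vermaOrbitMap_cartan, AlgHom.commutes,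
        Module.algebraMap_end_apply]
    · rw [smul_def, hφ.action_ι, inducedMap_one, vermaOrbitMap_nPlus wt hx]
  rwa [smul_def, hφ.action_envIncl, mul_one] at smul_one_eq_zero

variable (b wt) in
theorem isVermaGenerator_gen : IsVermaGenerator b wt (gen b wt) where
  mem_wtSpace := gen_mem_wtSpace
  nPlus_lie _ := lie_gen_eq_zero
  span_eq_top := span_nMinus_gen_eq_top
  eq_zero_of_smul_eq_zero _ := eq_zero_of_smul_gen_eq_zero

/-- The homomorphism from `Δ(wt)` to `Q` that maps the canonical generator to a given highest
weight vector of weight `wt`. -/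
def lift (hwt : q ∈ wtSpace H Q wt) (hpos : ∀ x ∈ nPlus b, ⁅x, q⁆ = 0) :
    Verma b wt →ₗ⁅ℂ,𝔤⁆ Q :=
  let f : Verma b wt →ₗ[𝒰 ℂ 𝔤] Q :=
    (vermaIdeal b wt).liftQ (LinearMap.toSpanSingleton (𝒰 ℂ 𝔤) Q q) fun _ hu =>
      smul_eq_zero_of_mem_vermaIdeal
        (fun h => by rw [ι_smul, algebraMap_smul, mem_wtSpace.1 hwt h])
        (fun x hx => by rw [ι_smul, hpos x hx]) hu
  { f.restrictScalars ℂ with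
    map_lie' := fun {x m} => (f.map_smul (ι ℂ x) m).trans (ι_smul x (f m)) }

theorem lift_gen (hwt : q ∈ wtSpace H Q wt) (hpos : ∀ x ∈ nPlus b, ⁅x, q⁆ = 0) :
    lift hwt hpos (gen b wt) = q :=
  one_smul (𝒰 ℂ 𝔤) q

end Verma

namespace IsVermaGenerator

theorem map (hq : IsVermaGenerator b wt q) {f : Q →ₗ⁅ℂ,𝔤⁆ Q'} (hf : Function.Bijective f) :
    IsVermaGenerator b wt (f q) where
  mem_wtSpace := map_mem_wtSpace f hq.mem_wtSpace
  nPlus_lie x hx := by rw [← LieModuleHom.map_lie, hq.nPlus_lie x hx, map_zero]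
  span_eq_top := by
    let f' := envHom (f.restrictLie (nMinus b))
    have range_eq_top : LinearMap.range f' = ⊤ := LinearMap.range_eq_top.2 hf.surjective
    rw [← range_eq_top, ← Submodule.map_top, ← hq.span_eq_top, map_span, Set.image_singleton]
    rfl
  eq_zero_of_smul_eq_zero u hu := by
    refine hq.eq_zero_of_smul_eq_zero u (hf.injective ?_)
    rw [map_zero, ← hu]
    exact (envHom (f.restrictLie (nMinus b))).map_smul u q

theorem nonempty_equiv (hq : IsVermaGenerator b wt q) : Nonempty (Q ≃ₗ⁅ℂ,𝔤⁆ Verma b wt) := by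
  let f := Verma.lift hq.mem_wtSpace hq.nPlus_lie
  let f' := envHom (f.restrictLie (nMinus b))
  have smul_gen (u : 𝒰 ℂ (nMinus b)) : f' (u • Verma.gen b wt) = u • q := by
    rw [map_smul]
    exact congrArg (u • ·) (Verma.lift_gen hq.mem_wtSpace hq.nPlus_lie)
  have injective : Function.Injective f' := by
    refine (injective_iff_map_eq_zero f').2 fun m hm => ?_
    obtain ⟨u, rfl⟩ := mem_span_singleton.1
      ((Verma.isVermaGenerator_gen b wt).span_eq_top ▸ mem_top : m ∈ _)
    rw [smul_gen] at hm
    rw [hq.eq_zero_of_smul_eq_zero u hm, zero_smul]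
  have surjective : Function.Surjective f' := fun m => by
    obtain ⟨u, rfl⟩ := mem_span_singleton.1 (hq.span_eq_top ▸ mem_top : m ∈ _)
    exact ⟨u • Verma.gen b wt, smul_gen u⟩
  let e : Verma b wt ≃ₗ⁅ℂ,𝔤⁆ Q :=
    { LinearEquiv.ofBijective (f : Verma b wt →ₗ[ℂ] Q) ⟨injective, surjective⟩ with
      map_lie' := f.map_lie' }
  exact ⟨e.symm⟩

end IsVermaGenerator

end VermaModules

/-! ### Verma filtrations -/

section Flags

variable {R M : Type*} [Ring R] [AddCommGroup M] [Module R M] {k : ℕ}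
  {F : Fin (k + 1) → Submodule R M} {v : Fin k → M}

theorem setOf_castSucc_lt_succ (i : Fin k) :
    {j : Fin k | j.castSucc < i.succ} = insert i {j | j.castSucc < i.castSucc} := by
  ext j
  simp [Fin.castSucc_lt_succ_iff, le_iff_eq_or_lt]

theorem span_castSucc_lt_eq_of_flag (h0 : F 0 = ⊥)
    (hF : ∀ i : Fin k, F i.succ = F i.castSucc ⊔ span R {v i}) (i : Fin (k + 1)) :
    span R (v '' {j | j.castSucc < i}) = F i := by
  induction i using Fin.induction with
  | zero => simp [h0]
  | succ i ih =>
    rw [setOf_castSucc_lt_succ, Set.image_insert_eq, span_insert, ih, hF, sup_comm]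

theorem linearIndependent_of_flag (h0 : F 0 = ⊥)
    (hF : ∀ i : Fin k, F i.succ = F i.castSucc ⊔ span R {v i})
    (hv : ∀ (i : Fin k) (r : R), r • v i ∈ F i.castSucc → r = 0) : LinearIndependent R v := by
  have linearIndepOn (i : Fin (k + 1)) : LinearIndepOn R v {j | j.castSucc < i} := by
    induction i using Fin.induction with
    | zero => simp
    | succ i ih =>
      rw [setOf_castSucc_lt_succ]
      exact ih.insert' fun r hr => hv i r (span_castSucc_lt_eq_of_flag h0 hF _ ▸ hr)
  simpa [Fin.castSucc_lt_last, linearIndepOn_univ_iff] using linearIndepOn (Fin.last k)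

theorem span_range_eq_top_of_flag (h0 : F 0 = ⊥) (hlast : F (Fin.last k) = ⊤)
    (hF : ∀ i : Fin k, F i.succ = F i.castSucc ⊔ span R {v i}) : span R (Set.range v) = ⊤ := by
  simpa [Fin.castSucc_lt_last, hlast] using span_castSucc_lt_eq_of_flag h0 hF (Fin.last k)

end Flags

section Subquotients

attribute [local instance] envModule envModule_isScalarTower

variable {L : Type*} [LieRing L] [LieAlgebra ℂ L] {n : LieSubalgebra ℂ L}
  {M : Type*} [AddCommGroup M] [Module ℂ M] [LieRingModule L M] [LieModule ℂ L M]
  {K P : LieSubmodule ℂ L M} {w : P}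

variable (K P) in
/-- The quotient map from a submodule `P` to its subquotient `P / (K ∩ P)`. -/
def subquotientMk : P →ₗ⁅ℂ,L⁆ P ⧸ K.comap P.incl := LieSubmodule.Quotient.mk' _

theorem subquotientMk_eq_zero_iff : subquotientMk K P w = 0 ↔ (w : M) ∈ K :=
  LieSubmodule.Quotient.mk_eq_zero _

theorem subquotientMk_surjective : Function.Surjective (subquotientMk K P) :=
  LieSubmodule.Quotient.surjective_mk' _

theorem smul_subquotientMk_eq_zero_iff {u : 𝒰 ℂ n} :
    u • subquotientMk K P w = 0 ↔ u • (w : M) ∈ K := by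
  have smul_mk : subquotientMk K P (u • w) = u • subquotientMk K P w :=
    (envHom ((subquotientMk K P).restrictLie n)).map_smul u w
  have coe_smul : ((u • w : P) : M) = u • (w : M) := (envHom (P.incl.restrictLie n)).map_smul u w
  rw [← smul_mk, subquotientMk_eq_zero_iff, coe_smul]

theorem span_subquotientMk_eq_top_iff (hKP : K ≤ P) :
    span (𝒰 ℂ n) {subquotientMk K P w} = ⊤ ↔
      envSubmodule n P = envSubmodule n K ⊔ span (𝒰 ℂ n) {(w : M)} := by
  let π := envHom ((subquotientMk K P).restrictLie n)
  let incl := envHom (P.incl.restrictLie n)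
  have range_incl : (⊤ : Submodule (𝒰 ℂ n) P).map incl = envSubmodule n P := by
    ext m
    exact ⟨fun ⟨p, _, hp⟩ => hp ▸ p.2, fun hm => ⟨⟨m, hm⟩, trivial, rfl⟩⟩
  have map_ker : (LinearMap.ker π).map incl = envSubmodule n K := by
    ext m
    exact ⟨fun ⟨p, hp, hpm⟩ => hpm ▸ subquotientMk_eq_zero_iff.1 hp,
      fun hm => ⟨⟨m, hKP hm⟩, subquotientMk_eq_zero_iff.2 hm, rfl⟩⟩
  have span_mk : span (𝒰 ℂ n) {subquotientMk K P w} = (span (𝒰 ℂ n) {w}).map π := by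
    rw [map_span, Set.image_singleton]; rfl
  have map_span_incl : (span (𝒰 ℂ n) {w}).map incl = span (𝒰 ℂ n) {(w : M)} := by
    rw [map_span, Set.image_singleton]; rfl
  have incl_injective : Function.Injective incl := P.injective_incl
  rw [span_mk, LinearMap.map_eq_top_iff (LinearMap.range_eq_top.2 subquotientMk_surjective),
    ← (map_injective_of_injective incl_injective).eq_iff, Submodule.map_sup, range_incl, map_ker,
    map_span_incl, sup_comm, eq_comm]

theorem exists_mem_wtSpace_subquotientMk_eq {H : LieSubalgebra ℂ L} [H.IsCartanSubalgebra]
    (hKP : K ≤ P) (hM : IsWeightModule H M) {wt : Module.Dual ℂ H} {q : P ⧸ K.comap P.incl}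
    (hq : q ∈ wtSpace H (P ⧸ K.comap P.incl) wt) :
    ∃ w : P, (w : M) ∈ wtSpace H M wt ∧ subquotientMk K P w = q := by
  obtain ⟨y, rfl⟩ := subquotientMk_surjective q
  let mkK := LieSubmodule.Quotient.mk' K
  have mkK_eq_zero {m : M} : mkK m = 0 ↔ m ∈ K := LieSubmodule.Quotient.mk_eq_zero _
  have mkK_y_mem : mkK y ∈ wtSpace H (M ⧸ K) wt := mem_wtSpace.2 fun h => by
    have := mem_wtSpace.1 hq h
    rw [← LieModuleHom.map_lie, ← map_smul, ← sub_eq_zero, ← map_sub,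
      subquotientMk_eq_zero_iff] at this
    rw [← LieModuleHom.map_lie, ← map_smul, ← sub_eq_zero, ← map_sub, mkK_eq_zero]
    exact this
  obtain ⟨m, hm, hmy⟩ :=
    exists_mem_wtSpace_apply_eq (LieSubmodule.Quotient.surjective_mk' K) hM mkK_y_mem
  have sub_mem : m - y ∈ K := by rw [← mkK_eq_zero, map_sub, sub_eq_zero]; exact hmy
  have m_mem : m ∈ P := sub_add_cancel m (y : M) ▸ add_mem (hKP sub_mem) y.2
  refine ⟨⟨m, m_mem⟩, hm, ?_⟩
  rw [← sub_eq_zero, ← map_sub, subquotientMk_eq_zero_iff]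
  exact sub_mem

end Subquotients

section VermaFiltrations

attribute [local instance] envModule envModule_isScalarTower

variable {𝔤 : Type*} [LieRing 𝔤] [LieAlgebra ℂ 𝔤] [FiniteDimensional ℂ 𝔤]
  [LieAlgebra.IsSemisimple ℂ 𝔤] {H : LieSubalgebra ℂ 𝔤} [H.IsCartanSubalgebra]
  {b : (IsKilling.rootSystem H).Base}
  {M : Type*} [AddCommGroup M] [Module ℂ M] [LieRingModule 𝔤 M] [LieModule ℂ 𝔤 M]

theorem isVermaGenerator_subquotientMk {K P : LieSubmodule ℂ 𝔤 M} (hKP : K ≤ P) {w : P}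
    {wt : Module.Dual ℂ H} (hw : (w : M) ∈ wtSpace H M wt)
    (hpos : ∀ x ∈ nPlus b, ⁅x, (w : M)⁆ ∈ K)
    (hspan : envSubmodule (nMinus b) P =
      envSubmodule (nMinus b) K ⊔ span (𝒰 ℂ (nMinus b)) {(w : M)})
    (hfree : ∀ u : 𝒰 ℂ (nMinus b), u • (w : M) ∈ K → u = 0) :
    IsVermaGenerator b wt (subquotientMk K P w) where
  mem_wtSpace := map_mem_wtSpace _ (mem_wtSpace.2 fun h => Subtype.ext (mem_wtSpace.1 hw h))
  nPlus_lie x hx := by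
    rw [← LieModuleHom.map_lie, subquotientMk_eq_zero_iff]
    exact hpos x hx
  span_eq_top := (span_subquotientMk_eq_top_iff hKP).2 hspan
  eq_zero_of_smul_eq_zero u hu := hfree u (smul_subquotientMk_eq_zero_iff.1 hu)

theorem IsWeightBasis.hasVermaFiltration_of_sorted {k : ℕ} {v : Fin k → M}
    {κ : Fin k → Module.Dual ℂ H} (hv : IsWeightBasis b v κ)
    (hsort : ∀ i j, b.IsPos j → ∀ l, WeightLE b (j.1.toLinear + κ i) (κ l) → l < i) :
    HasVermaFiltration b M := by
  have isUpper (i : Fin (k + 1)) : ∀ l ∈ {l : Fin k | l.castSucc < i}, ∀ j, b.IsPos j →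
      ∀ l', WeightLE b (j.1.toLinear + κ l) (κ l') → l' ∈ {l : Fin k | l.castSucc < i} :=
    fun l hl j hj l' hl' => (Fin.castSucc_lt_castSucc_iff.2 (hsort l j hj l' hl')).trans hl
  let F (i : Fin (k + 1)) : LieSubmodule ℂ 𝔤 M := hv.spanLie _ (isUpper i)
  have mem_F {i m} : m ∈ F i ↔
    m ∈ span (𝒰 ℂ (nMinus b)) (v '' {l : Fin k | l.castSucc < i}) := Iff.rfl
  have F_mono : Monotone F := fun i j hij m hm => by
    rw [mem_F] at hm ⊢
    exact span_mono (Set.image_mono (Set.ofPred_subset_ofPred.2 fun l hl => hl.trans_le hij)) hm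
  refine ⟨k, F, ?_, ?_, fun i => ⟨F_mono i.castSucc_lt_succ.le, κ i, ?_⟩⟩
  · ext m
    simp [mem_F]
  · ext m
    simp [mem_F, Fin.castSucc_lt_last, hv.span_eq_top]
  · have v_mem : v i ∈ F i.succ := subset_span ⟨i, Fin.castSucc_lt_succ, rfl⟩
    refine (isVermaGenerator_subquotientMk (w := ⟨v i, v_mem⟩) (F_mono i.castSucc_lt_succ.le)
      (hv.mem_wtSpace i) (fun x hx => ?_) ?_ fun u hu => ?_).nonempty_equiv
    · refine hv.nPlus_lie_mem (fun j hj l hl => ?_) hx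
      exact Fin.castSucc_lt_castSucc_iff.2 (hsort i j hj l hl)
    · change span _ (v '' _) = span _ (v '' _) ⊔ _
      rw [setOf_castSucc_lt_succ, Set.image_insert_eq, span_insert, sup_comm]
    · refine linearIndependent_iff_eq_zero_of_smul_mem_span.1 hv.linearIndependent i u
        (span_mono (Set.image_mono fun l hl => ?_) (mem_F.1 hu))
      exact ⟨trivial, (Fin.castSucc_lt_castSucc_iff.1 hl).ne⟩

theorem IsWeightBasis.reindex {I J : Type*} {v : I → M} {κ : I → Module.Dual ℂ H}
    (hv : IsWeightBasis b v κ) (e : J ≃ I) : IsWeightBasis b (v ∘ e) (κ ∘ e) where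
  mem_wtSpace j := hv.mem_wtSpace (e j)
  span_eq_top := by rw [e.surjective.range_comp, hv.span_eq_top]
  linearIndependent := hv.linearIndependent.comp e e.injective

theorem IsWeightBasis.inFDelta {I : Type*} [Finite I] {v : I → M} {κ : I → Module.Dual ℂ H}
    (hv : IsWeightBasis b v κ) : InFDelta b M := by
  refine ⟨hv.inO, ?_⟩
  obtain ⟨k, ⟨e⟩⟩ := Finite.exists_equiv_fin I
  let height (l : Fin k) : ℝ := weightHeight b (κ (e.symm l))
  let σ : Fin k ≃ I := (Tuple.sort (-height)).trans e.symm
  have antitone : Antitone fun l => weightHeight b (κ (σ l)) := fun _ _ h =>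
    neg_le_neg_iff.1 (Tuple.monotone_sort (-height) h)
  refine (hv.reindex σ).hasVermaFiltration_of_sorted fun i j hj l hl => ?_
  exact antitone.reflect_lt (weightHeight_lt_of_weightLE hj hl)

theorem exists_weight_vector_of_subquotient_equiv {K P : LieSubmodule ℂ 𝔤 M} (hKP : K ≤ P)
    (hM : IsWeightModule H M) {wt : Module.Dual ℂ H}
    (e : (P ⧸ K.comap P.incl) ≃ₗ⁅ℂ,𝔤⁆ Verma b wt) :
    ∃ m ∈ wtSpace H M wt,
      envSubmodule (nMinus b) P = envSubmodule (nMinus b) K ⊔ span (𝒰 ℂ (nMinus b)) {m} ∧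
      ∀ u : 𝒰 ℂ (nMinus b), u • m ∈ K → u = 0 := by
  have hq := (Verma.isVermaGenerator_gen b wt).map (f := e.symm.toLieModuleHom)
    e.symm.toLinearEquiv.bijective
  obtain ⟨w, hw, hwq⟩ := exists_mem_wtSpace_subquotientMk_eq hKP hM hq.mem_wtSpace
  rw [← hwq] at hq
  exact ⟨w, hw, (span_subquotientMk_eq_top_iff hKP).1 hq.span_eq_top,
    fun u hu => hq.eq_zero_of_smul_eq_zero u (smul_subquotientMk_eq_zero_iff.2 hu)⟩

theorem InFDelta.exists_isWeightBasis (hM : InFDelta b M) :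
    ∃ (k : ℕ) (v : Fin k → M) (κ : Fin k → Module.Dual ℂ H), IsWeightBasis b v κ := by
  obtain ⟨k, F, h0, hlast, hF⟩ := hM.hasVermaFiltration
  choose hle κ e using hF
  choose v hv hspan hfree using fun i =>
    exists_weight_vector_of_subquotient_equiv (hle i) hM.inO.isWeightModule (e i).some
  have bot : envSubmodule (nMinus b) (F 0) = ⊥ := by rw [h0]; rfl
  have top : envSubmodule (nMinus b) (F (Fin.last k)) = ⊤ := by rw [hlast]; rfl
  let F' (i) := envSubmodule (nMinus b) (F i)
  exact ⟨k, v, κ, ⟨hv, span_range_eq_top_of_flag (F := F') bot top hspan⟩,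
    linearIndependent_of_flag (F := F') bot hspan hfree⟩

end VermaFiltrations

/-! ### The restricted dual -/

section DualBasis

variable {𝔤 : Type*} [LieRing 𝔤] [LieAlgebra ℂ 𝔤] {H : LieSubalgebra ℂ 𝔤}
  {N : Type*} [AddCommGroup N] [Module ℂ N] [LieRingModule 𝔤 N] [LieModule ℂ 𝔤 N]
  {J : Type*} {B : Module.Basis J ℂ N} {κ : J → Module.Dual ℂ H}

theorem coord_lie (hB : ∀ j, B j ∈ wtSpace H N (κ j)) (h : H) (j : J) (m : N) :
    B.coord j ⁅(h : 𝔤), m⁆ = κ j h • B.coord j m := by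
  have : B.coord j ∘ₗ toEnd ℂ 𝔤 N h = κ j h • B.coord j := B.ext fun k => by
    by_cases hkj : k = j <;> simp [hkj, mem_wtSpace.1 (hB _) h]
  exact LinearMap.congr_fun this m

theorem coord_mem_wtSpace (hB : ∀ j, B j ∈ wtSpace H N (κ j)) (j : J) :
    B.coord j ∈ wtSpace H (Module.Dual ℂ N) (-κ j) :=
  mem_wtSpace.2 fun h => LinearMap.ext fun m => by simp [-Module.Basis.coord_apply, coord_lie hB]

theorem dual_mem_span_coord {f : Module.Dual ℂ N} (hf : {j | f (B j) ≠ 0}.Finite) :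
    f ∈ span ℂ (Set.range B.coord) := by
  classical
  have : f = ∑ j ∈ hf.toFinset, f (B j) • B.coord j := B.ext fun k => by
    simp [Finsupp.single_apply]
  rw [this]
  exact sum_mem fun j _ => smul_mem _ _ (subset_span ⟨j, rfl⟩)

variable (H N) in
/-- The index type of a basis of weight vectors of `N`; the first component is the weight. -/
abbrev WeightIndex : Type _ := Σ μ : Module.Dual ℂ H, Fin (Module.finrank ℂ (wtSpace H N μ))

theorem finite_weightIndex_preimage {S : Set (Module.Dual ℂ H)} (hS : S.Finite) :
    {j : WeightIndex H N | j.1 ∈ S}.Finite :=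
  hS.preimage' fun μ _ => Set.range_sigmaMk μ ▸ Set.finite_range _

end DualBasis

section RestrictedDual

variable {𝔤 : Type*} [LieRing 𝔤] [LieAlgebra ℂ 𝔤] [FiniteDimensional ℂ 𝔤]
  [LieAlgebra.IsSemisimple ℂ 𝔤] {H : LieSubalgebra ℂ 𝔤} [H.IsCartanSubalgebra]
  {b : (IsKilling.rootSystem H).Base}
  {N : Type*} [AddCommGroup N] [Module ℂ N] [LieRingModule 𝔤 N] [LieModule ℂ 𝔤 N]
  {J : Type*} {B : Module.Basis J ℂ N} {κ : J → Module.Dual ℂ H}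

theorem coord_mem_restrictedDual (hB : ∀ j, B j ∈ wtSpace H N (κ j)) (j : J) :
    B.coord j ∈ restrictedDual H N := by
  refine (Set.finite_singleton (κ j)).subset ?_
  rintro μ ⟨m, hm, hne⟩
  refine LinearMap.ext fun h => ?_
  have := coord_lie hB h j m
  rw [mem_wtSpace.1 hm h, map_smul] at this
  exact smul_left_injective ℂ hne this

theorem span_coord_eq_restrictedDual (hB : ∀ j, B j ∈ wtSpace H N (κ j))
    (hκ : ∀ μ, {j | κ j = μ}.Finite) :
    span ℂ (Set.range B.coord) = (restrictedDual H N).toSubmodule := by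
  refine le_antisymm (span_le.2 ?_) fun f hf => dual_mem_span_coord ?_
  · rintro _ ⟨j, rfl⟩
    exact coord_mem_restrictedDual hB j
  · have hf : {μ : Module.Dual ℂ H | ∃ m ∈ (weightSpace N (μ : H → ℂ) : LieSubmodule ℂ H N),
      f m ≠ 0}.Finite := hf
    exact (hf.preimage' fun μ _ => hκ μ).subset fun j hj => ⟨B j, hB j, hj⟩

namespace InOTilde

theorem isInternal_wtSpace [DecidableEq (Module.Dual ℂ H)] (hN : InOTilde b N) :
    DirectSum.IsInternal (wtSpace H N) :=
  DirectSum.isInternal_submodule_of_iSupIndep_of_iSup_eq_top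
    (iSupIndep_wtSpace H N) (isWeightModule_iff.1 hN.isWeightModule)

open scoped Classical in
/-- A basis of weight vectors of a module in `𝒪~`. -/
def weightBasis (hN : InOTilde b N) : Module.Basis (WeightIndex H N) ℂ N :=
  let _ (μ : Module.Dual ℂ H) : FiniteDimensional ℂ (wtSpace H N μ) := hN.finiteDimensional μ
  hN.isInternal_wtSpace.collectedBasis fun μ => Module.finBasis ℂ (wtSpace H N μ)

theorem weightBasis_mem_wtSpace (hN : InOTilde b N) (j : WeightIndex H N) :
    hN.weightBasis j ∈ wtSpace H N j.1 := by
  classical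
  exact DirectSum.IsInternal.collectedBasis_mem _ _ j

/-- The basis of `N^*` dual to `weightBasis`. -/
def dualBasis (hN : InOTilde b N) (j : WeightIndex H N) : restrictedDual H N :=
  ⟨hN.weightBasis.coord j, coord_mem_restrictedDual hN.weightBasis_mem_wtSpace j⟩

theorem dualBasis_mem_wtSpace (hN : InOTilde b N) (j : WeightIndex H N) :
    hN.dualBasis j ∈ wtSpace H (restrictedDual H N) (-j.1) :=
  mem_wtSpace.2 fun h => Subtype.ext
    (mem_wtSpace.1 (coord_mem_wtSpace hN.weightBasis_mem_wtSpace j) h)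

theorem linearIndependent_dualBasis (hN : InOTilde b N) : LinearIndependent ℂ hN.dualBasis :=
  LinearIndependent.of_comp (restrictedDual H N).toSubmodule.subtype
    hN.weightBasis.linearIndependent_coord

theorem span_dualBasis (hN : InOTilde b N) : span ℂ (Set.range hN.dualBasis) = ⊤ := by
  refine (span_range_subtype_eq_top_iff (restrictedDual H N).toSubmodule
    (coord_mem_restrictedDual hN.weightBasis_mem_wtSpace)).2 ?_
  exact span_coord_eq_restrictedDual hN.weightBasis_mem_wtSpace
    fun μ => finite_weightIndex_preimage (Set.finite_singleton μ)

theorem finite_weightLE_neg (hN : InOTilde b N) (ξ : Module.Dual ℂ H) :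
    {j : WeightIndex H N | WeightLE b (-j.1) ξ}.Finite := by
  obtain ⟨S, hS⟩ := hN.support_le
  have finite_union := S.finite_toSet.biUnion fun ν _ => finite_weightIndex_preimage (N := N)
    ((finite_weightLE_interval (b := b) (-ν) ξ).preimage neg_injective.injOn)
  refine finite_union.subset fun j hj => ?_
  have wtSpace_ne_bot : wtSpace H N j.1 ≠ ⊥ := fun h => by
    have := j.2.pos
    rw [h, finrank_bot] at this
    exact this.false
  obtain ⟨ν, hν, hle⟩ := hS j.1 fun h => wtSpace_ne_bot (by rw [wtSpace, h]; rfl)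
  refine Set.mem_biUnion hν ⟨?_, hj⟩
  rwa [WeightLE, neg_sub_neg]

end InOTilde

theorem finite_weightLE_add {I J : Type*} [Finite I] (κ : I → Module.Dual ℂ H)
    {κ' : J → Module.Dual ℂ H} (h : ∀ ξ, {j | WeightLE b (κ' j) ξ}.Finite) (wt : Module.Dual ℂ H) :
    Finite {p : I × J // WeightLE b (κ p.1 + κ' p.2) wt} := by
  have finite_fiber (i : I) : Finite {j // WeightLE b (κ i + κ' j) wt} := by
    have := (h (wt - κ i)).to_subtype
    simp only [WeightLE, sub_sub] at this
    exact this
  exact Finite.of_equiv _ (Equiv.subtypeProdEquivSigmaSubtype fun i j =>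
    WeightLE b (κ i + κ' j) wt).symm

end RestrictedDual

end CatO

end

theorem proposition2p9 {𝔤 : Type*} [LieRing 𝔤] [LieAlgebra ℂ 𝔤] [FiniteDimensional ℂ 𝔤]
    [LieAlgebra.IsSemisimple ℂ 𝔤] (H : LieSubalgebra ℂ 𝔤) [H.IsCartanSubalgebra]
    (b : (LieAlgebra.IsKilling.rootSystem H).Base)
    (M : Type*) [AddCommGroup M] [Module ℂ M] [LieRingModule 𝔤 M] [LieModule ℂ 𝔤 M]
    (N : Type*) [AddCommGroup N] [Module ℂ N] [LieRingModule 𝔤 N] [LieModule ℂ 𝔤 N]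
    (hN : CatO.InOTilde b N) (wt : Module.Dual ℂ H) :
    (CatO.InFDelta b M →
      CatO.InFDelta b (CatO.Trunc b wt (M ⊗[ℂ] CatO.restrictedDual H N)) ∧
      CatO.EnvFinite (CatO.nMinus b) (CatO.Trunc b wt (M ⊗[ℂ] CatO.restrictedDual H N)) ∧
      CatO.EnvFree (CatO.nMinus b) (CatO.Trunc b wt (M ⊗[ℂ] CatO.restrictedDual H N))) ∧
    (CatO.InO b M →
      CatO.InO b (CatO.Trunc b wt (M ⊗[ℂ] CatO.restrictedDual H N))) := by
  constructor
  · intro hM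
    obtain ⟨k, v, κ, hv⟩ := hM.exists_isWeightBasis
    have := CatO.finite_weightLE_add κ hN.finite_weightLE_neg wt
    have basis := (hv.tmul hN.dualBasis_mem_wtSpace hN.span_dualBasis
      hN.linearIndependent_dualBasis).trunc wt
    exact ⟨basis.inFDelta, basis.inO.finite, basis.envFree⟩
  · intro hM
    obtain ⟨s, κ, hv⟩ := hM.exists_isWeightGenerating
    have := CatO.finite_weightLE_add κ hN.finite_weightLE_neg wt
    exact ((hv.tmul hN.dualBasis_mem_wtSpace hN.span_dualBasis).trunc wt).inO
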